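/- **Theorem 4.4.** For $d\in\mathbb N$ let $\mathbb M_d^{sa}$ be the space of $d\times d$ Hermitian complex matrices with the Löwner order $\preceq$, and let $\mathbb M_d^{+}$ and $\mathbb M_d^{++}$ be its subsets of positive semidefinite and positive definite matrices; convexity of a matrix-valued map is meant in the Löwner order. Let $\Phi:[0,\infty)\to\mathbb R$ be convex and continuous, and for $A\in\mathbb M_d^{+}$ let $\Phi(A)$ be given by the functional calculus. Assume that for every $d$ the map $A\mapsto\Phi(A)$ is twice Fréchet differentiable at every point of $\mathbb M_d^{++}$, with derivatives $\mathsf D\Phi[A](B)$ and $\mathsf D^2\Phi[A](B,C)$ for $B,C\in\mathbb M_d^{sa}$. Let $(\mathbf{C3})$ be the class of functions for which, in every dimension $d$, this second derivative exists and $(A,B)\mapsto\mathsf D^2\Phi[A](B,B)$ is jointly convex on $\mathbb M_d^{++}\times\mathbb M_d^{sa}$. For a random matrix $Z$ with values in $\mathbb M_d^{+}$, on any probability space, such that $Z$ and $\Phi(Z)$ are Bochner integrable ("admissible for $\Phi$"), put $$\boldsymbol H_\Phi(Z)=\mathbb E\,\Phi(Z)-\Phi(\mathbb E Z).$$ The following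 statements about $\Phi$ are equivalent, where (b)–(i) are required for every $d$. (a) $\Phi\in(\mathbf{C3})$. (b) $(A,B)\mapsto\Phi(A+B)-\Phi(A)-\mathsf D\Phi[A](B)$ is jointly convex on $\{(A,B)\in\mathbb M_d^{sa}\times\mathbb M_d^{sa}: A\succ0,\ A+B\succ0\}$. (c) $(A,B)\mapsto\mathsf D\Phi[A+B](B)-\mathsf D\Phi[A](B)$ is jointly convex on the same set. (d) $(A,B)\mapsto\mathsf D^2\Phi[A](B,B)$ is jointly convex on $\mathbb M_d^{++}\times\mathbb M_d^{sa}$. (e) For every $t\in[0,1]$, the map $F_t(A,B)=t\Phi(A)+(1-t)\Phi(B)-\Phi(tA+(1-t)B)$ is jointly convex on $\mathbb M_d^{+}\times\mathbb M_d^{+}$. (f) For all independent random variables $X_1,X_2$ with values in Polish spaces and every admissible $Z=Z(X_1,X_2)$, with $Z(\cdot,\cdot)\in\mathbb M_d^+$ measurable, $\mathbb E_1\boldsymbol H_\Phi(Z\mid X_1)\succeq\boldsymbol H_\Phi(\mathbb E_1Z)$. Here $\mathbb E_i$ denotes integration over $X_i$ with the other variable fixed, and $\boldsymbol H_\Phi(Z\mid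 X_1)=\mathbb E_2\Phi(Z)-\Phi(\mathbb E_2Z)$. (g) On every probability space, $Z\mapsto\boldsymbol H_\Phi(Z)$ is convex on the (convex) set of admissible $\mathbb M_d^{+}$-valued random matrices. (h) On every probability space and for every admissible $Z$ with values in $\mathbb M_d^{++}$, $$\boldsymbol H_\Phi(Z)=\sup_{T\succ0}\Big\{\mathbb E\big[\mathsf D\Phi[T](Z-T)-\mathsf D\Phi[\mathbb ET](Z-T)\big]+\boldsymbol H_\Phi(T)\Big\},$$ where the supremum is the least upper bound in the Löwner order and $T$ ranges over the admissible random matrices with values in $\mathbb M_d^{++}$ for which $\mathsf D\Phi[T](Z-T)$ is Bochner integrable. (i) For every $n$, all independent random variables $X_1,\dots,X_n$ with values in Polish spaces, and every admissible $Z=Z(X_1,\dots,X_n)$, with $Z(\cdot)\in\mathbb M_d^+$ measurable, $\boldsymbol H_\Phi(Z)\preceq\sum_{i=1}^n\mathbb E\,\boldsymbol H^{(i)}_\Phi(Z)$. Here $\boldsymbol H^{(i)}_\Phi(Z)=\mathbb E_i\Phi(Z)-\Phi(\mathbb E_iZ)$, and $\mathbb E_i$ denotes integration over $X_i$ with the other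 variables fixed. Moreover, the entropies $\{\boldsymbol H_\Phi\}$ with $\Phi$ in $(\mathbf{C3})$ (and satisfying the assumptions above) form a convex set: if $\Phi_0,\Phi_1$ are two such functions and $a,b\ge0$ with $a+b=1$, then $a\Phi_0+b\Phi_1$ is such a function, and every $Z$ admissible for both $\Phi_0$ and $\Phi_1$ is admissible for $a\Phi_0+b\Phi_1$, with $\boldsymbol H_{a\Phi_0+b\Phi_1}(Z)=a\boldsymbol H_{\Phi_0}(Z)+b\boldsymbol H_{\Phi_1}(Z)$. -/

import Mathlib

open MeasureTheory ProbabilityTheory Set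
open scoped Matrix.Norms.L2Operator MatrixOrder ComplexOrder

universe u

noncomputable section

/-- The real Banach space of `d × d` Hermitian complex matrices, with the operator norm and
the Löwner order. -/
abbrev HermMat (d : ℕ) : Type := selfAdjoint (Matrix (Fin d) (Fin d) ℂ)

/-- In particular `HermMat d` is complete, so that Bochner integrals are meaningful. -/
instance HermMat.instFiniteDimensional (d : ℕ) : FiniteDimensional ℝ (HermMat d) :=
  inferInstanceAs (FiniteDimensional ℝ (selfAdjoint.submodule ℝ (Matrix (Fin d) (Fin d) ℂ)))

theorem HermMat.completeSpace (d : ℕ) : CompleteSpace (HermMat d) :=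
  FiniteDimensional.complete ℝ (HermMat d)

/-- The order on `HermMat d` is the Löwner order. -/
theorem HermMat.le_iff {d : ℕ} (A B : HermMat d) :
    A ≤ B ↔ ((B : Matrix (Fin d) (Fin d) ℂ) - A).PosSemidef := by
  rw [← Subtype.coe_le_coe, Matrix.le_iff]

/-- Positive definiteness of a Hermitian matrix. -/
def PosDefH {d : ℕ} (A : HermMat d) : Prop := (A : Matrix (Fin d) (Fin d) ℂ).PosDef

/-- The standard matrix function `A ↦ Φ(A)`, that is, `Φ` applied to the eigenvalues of `A`.
Only the values of `Φ` on the spectrum of `A` matter. -/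
def matFun (Φ : ℝ → ℝ) {d : ℕ} (A : HermMat d) : HermMat d :=
  ⟨cfc Φ (A : Matrix (Fin d) (Fin d) ℂ), cfc_predicate Φ (A : Matrix (Fin d) (Fin d) ℂ)⟩

/-- First Fréchet derivative `DΦ[A](B)` of the matrix function. -/
def dMat (Φ : ℝ → ℝ) {d : ℕ} (A B : HermMat d) : HermMat d :=
  fderiv ℝ (matFun Φ (d := d)) A B

/-- Second Fréchet derivative `D²Φ[A](B, C)` of the matrix function. -/
def d2Mat (Φ : ℝ → ℝ) {d : ℕ} (A B C : HermMat d) : HermMat d :=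
  fderiv ℝ (fderiv ℝ (matFun Φ (d := d))) A B C

/-- The matrix function of `Φ` is twice Fréchet differentiable at every positive definite `d × d`
matrix. -/
def TwiceFrechetDiff (Φ : ℝ → ℝ) (d : ℕ) : Prop :=
  ∀ A : HermMat d, PosDefH A →
    DifferentiableAt ℝ (matFun Φ (d := d)) A ∧
      DifferentiableAt ℝ (fderiv ℝ (matFun Φ (d := d))) A

/-- The standing assumptions on `Φ : [0, ∞) → ℝ` (values of `Φ` at negative numbers play no role):
convex, continuous, and twice Fréchet differentiable as a matrix function in every dimension. -/
structure IsEntropyFun (Φ : ℝ → ℝ) : Prop where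
  convexOn : ConvexOn ℝ (Ici 0) Φ
  continuousOn : ContinuousOn Φ (Ici 0)
  twiceFrechetDiff : ∀ d : ℕ, TwiceFrechetDiff Φ d

/-- The pairs `(A, B)` of Hermitian matrices with `A` positive definite. -/
def pairsPD (d : ℕ) : Set (HermMat d × HermMat d) := {p | PosDefH p.1}

/-- The pairs `(A, B)` of Hermitian matrices with `A` and `A + B` positive definite. -/
def pairsPDAdd (d : ℕ) : Set (HermMat d × HermMat d) := {p | PosDefH p.1 ∧ PosDefH (p.1 + p.2)}

/-- The pairs `(A, B)` of positive semidefinite matrices. -/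
def pairsPSD (d : ℕ) : Set (HermMat d × HermMat d) := {p | 0 ≤ p.1 ∧ 0 ≤ p.2}

/-- `(A, B) ↦ D²Φ[A](B, B)` is jointly convex in the Löwner order on pairs of `d × d` matrices. -/
def SecondDerivConvex (Φ : ℝ → ℝ) (d : ℕ) : Prop :=
  ConvexOn ℝ (pairsPD d) (fun p => d2Mat Φ p.1 p.2 p.2)

/-- The class of functions with a second Fréchet derivative that is jointly convex, in
dimension `d`. -/
def opEntropyClass (d : ℕ) : Set (ℝ → ℝ) :=
  {Φ | TwiceFrechetDiff Φ d ∧ SecondDerivConvex Φ d}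

/-- The operator-valued entropy class (C3): the intersection over all dimensions. -/
def classC3 : Set (ℝ → ℝ) := ⋂ d : ℕ, opEntropyClass d

/-- The operator-valued Bregman divergence `Φ(A + B) - Φ(A) - DΦ[A](B)`. -/
def bregman (Φ : ℝ → ℝ) {d : ℕ} (A B : HermMat d) : HermMat d :=
  matFun Φ (A + B) - matFun Φ A - dMat Φ A B

/-- The map `F_t(A, B) = t Φ(A) + (1 - t) Φ(B) - Φ(t A + (1 - t) B)`. -/
def jensenGap (Φ : ℝ → ℝ) (t : ℝ) {d : ℕ} (A B : HermMat d) : HermMat d :=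
  t • matFun Φ A + (1 - t) • matFun Φ B - matFun Φ (t • A + (1 - t) • B)

/-- The random positive semidefinite matrices `Z` for which `Z` and `Φ(Z)` are Bochner
integrable. -/
def psdDomain (Φ : ℝ → ℝ) (d : ℕ) {Ω : Type u} [MeasurableSpace Ω] (P : Measure Ω) :
    Set (Ω → HermMat d) :=
  {Z | (∀ ω, 0 ≤ Z ω) ∧ Integrable Z P ∧ Integrable (fun ω => matFun Φ (Z ω)) P}

/-- The random positive definite matrices `Z` for which `Z` and `Φ(Z)` are Bochner integrable. -/
def pdDomain (Φ : ℝ → ℝ) (d : ℕ) {Ω : Type u} [MeasurableSpace Ω] (P : Measure Ω) :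
    Set (Ω → HermMat d) :=
  {Z | (∀ ω, PosDefH (Z ω)) ∧ Integrable Z P ∧ Integrable (fun ω => matFun Φ (Z ω)) P}

/-- The operator-valued `Φ`-entropy `H_Φ(Z) = E Φ(Z) - Φ(E Z)`, the expectation being with respect
to `P`. -/
def opEntropy (Φ : ℝ → ℝ) {d : ℕ} {Ω : Type u} [MeasurableSpace Ω] (P : Measure Ω)
    (Z : Ω → HermMat d) : HermMat d :=
  (∫ ω, matFun Φ (Z ω) ∂P) - matFun Φ (∫ ω, Z ω ∂P)

/-- Conditional Jensen inequality `E₁ H_Φ(Z | X₁) ≽ H_Φ(E₁ Z)` for independent `X₁`, `X₂` with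
values in Polish spaces and `Z = f(X₁, X₂)`. By independence, `H_Φ(Z | X₁)` at `X₁ = x₁` is the
entropy of `f(x₁, ·)` under the law of `X₂`, and `E₁ Z` at `X₂ = x₂` is the integral of `f(·, x₂)`
under the law of `X₁`. -/
def CondJensen (Φ : ℝ → ℝ) : Prop :=
  ∀ (d : ℕ) (Ω S₁ S₂ : Type u) [MeasurableSpace Ω]
    [TopologicalSpace S₁] [PolishSpace S₁] [MeasurableSpace S₁] [BorelSpace S₁]
    [TopologicalSpace S₂] [PolishSpace S₂] [MeasurableSpace S₂] [BorelSpace S₂]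
    (P : Measure Ω) [IsProbabilityMeasure P] (X₁ : Ω → S₁) (X₂ : Ω → S₂)
    (f : S₁ × S₂ → HermMat d),
    Measurable X₁ → Measurable X₂ → IndepFun X₁ X₂ P → StronglyMeasurable f → (∀ x, 0 ≤ f x) →
    (fun ω => f (X₁ ω, X₂ ω)) ∈ psdDomain Φ d P →
    opEntropy Φ P (fun ω => ∫ x₁, f (x₁, X₂ ω) ∂(P.map X₁)) ≤
      ∫ ω, opEntropy Φ (P.map X₂) (fun x₂ => f (X₁ ω, x₂)) ∂P

/-- `Z ↦ H_Φ(Z)` is convex in the Löwner order, on every probability space. -/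
def EntropyConvex (Φ : ℝ → ℝ) : Prop :=
  ∀ (d : ℕ) (Ω : Type u) [MeasurableSpace Ω] (P : Measure Ω) [IsProbabilityMeasure P],
    ConvexOn ℝ (psdDomain Φ d P) (opEntropy Φ P)

/-- The matrices `E[DΦ[T](Z - T) - DΦ[E T](Z - T)] + H_Φ(T)`, where `T` ranges over the random
positive definite matrices in the domain of the entropy for which this expectation exists. -/
def dualValues (Φ : ℝ → ℝ) {d : ℕ} {Ω : Type u} [MeasurableSpace Ω] (P : Measure Ω)
    (Z : Ω → HermMat d) : Set (HermMat d) :=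
  {V | ∃ T ∈ pdDomain Φ d P, Integrable (fun ω => dMat Φ (T ω) (Z ω - T ω)) P ∧
    V = (∫ ω, (dMat Φ (T ω) (Z ω - T ω) - dMat Φ (∫ ω', T ω' ∂P) (Z ω - T ω)) ∂P) +
      opEntropy Φ P T}

/-- Supremum representation: `H_Φ(Z)` is the least upper bound, in the Löwner order, of the
dual values. -/
def SupRepresentation (Φ : ℝ → ℝ) : Prop :=
  ∀ (d : ℕ) (Ω : Type u) [MeasurableSpace Ω] (P : Measure Ω) [IsProbabilityMeasure P],
    ∀ Z ∈ pdDomain Φ d P, IsLUB (dualValues Φ P Z) (opEntropy Φ P Z)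

/-- Subadditivity `H_Φ(Z) ≼ ∑ i, E H_Φ^{(i)}(Z)` for `Z = f(X₁, …, Xₙ)` and independent `Xᵢ` with
values in Polish spaces. By independence, `H_Φ^{(i)}(Z) = E_i Φ(Z) - Φ(E_i Z)` is the entropy of `f`
as a function of its `i`-th argument alone, under the law of `Xᵢ`. -/
def EntropySubadditive (Φ : ℝ → ℝ) : Prop :=
  ∀ (d n : ℕ) (Ω : Type u) (S : Fin n → Type u) [MeasurableSpace Ω]
    [∀ i, TopologicalSpace (S i)] [∀ i, PolishSpace (S i)]
    [∀ i, MeasurableSpace (S i)] [∀ i, BorelSpace (S i)]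
    (P : Measure Ω) [IsProbabilityMeasure P] (X : ∀ i, Ω → S i) (f : (∀ i, S i) → HermMat d),
    (∀ i, Measurable (X i)) → iIndepFun X P → StronglyMeasurable f → (∀ x, 0 ≤ f x) →
    (fun ω => f (fun j => X j ω)) ∈ psdDomain Φ d P →
    opEntropy Φ P (fun ω => f (fun j => X j ω)) ≤
      ∑ i, ∫ ω, opEntropy Φ (P.map (X i))
        (fun y => f (Function.update (fun j => X j ω) i y)) ∂P

/-- The operator-valued entropies of the functions in (C3) form a convex set: convex combinations
of functions in the class stay in it, and `Φ ↦ H_Φ(Z)` respects them. -/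
def EntropyFamilyConvex : Prop :=
  Convex ℝ {Φ : ℝ → ℝ | IsEntropyFun Φ ∧ Φ ∈ classC3} ∧
  ∀ Φ₀ Φ₁ : ℝ → ℝ, IsEntropyFun Φ₀ → IsEntropyFun Φ₁ → Φ₀ ∈ classC3 → Φ₁ ∈ classC3 →
    ∀ a b : ℝ, 0 ≤ a → 0 ≤ b → a + b = 1 →
    ∀ (d : ℕ) (Ω : Type u) [MeasurableSpace Ω] (P : Measure Ω) [IsProbabilityMeasure P]
      (Z : Ω → HermMat d), Z ∈ psdDomain Φ₀ d P → Z ∈ psdDomain Φ₁ d P →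
      Z ∈ psdDomain (a • Φ₀ + b • Φ₁) d P ∧
        opEntropy (a • Φ₀ + b • Φ₁) P Z = a • opEntropy Φ₀ P Z + b • opEntropy Φ₁ P Z

end

/-! The Bregman divergence `bregman Φ A B` is the hub: each other property is either equivalent to
its joint convexity by calculus on segments, or is Jensen's inequality for it.

Write `D(A, B)` for `bregman Φ A B`. Along `s ↦ A + s • B`, the second derivative integrates to (c),
and (c) integrates to `D`. Backwards, `D(A, B) + D(A + B, -B)` is exactly (c), and (c) at `(A, s •
B)` divided by `s ^ 2` tends to the second derivative. With `C = t A + (1 - t) B`, the gap `F_t(A,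
B)` equals `t D(C, A - C) + (1 - t) D(C, B - C)`, since the linear terms cancel; and `D(A, B)` is
the limit of `F_s(A + B, A) / s` as `s` decreases to `0`.

Each entropy inequality is a Jensen gap. In (g) the convexity defect is `E F_a(Y, Z) - F_a(E Y, E
Z)`. In (h) the entropy minus a dual value is `E D(T, Z - T) - D(E T, E Z - E T)`, which vanishes at
`T = Z`. In (f), with `W = E₁ Z`, `V = E₂ Z`, `M = E Z`, the two sides are `E D(W, Z - W)` and `E
D(M, V - M)`, compared by Jensen in `X₂` at fixed `X₁` (`entropy_two_blocks_of_posDefH`). Then (i)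
follows from (f) by peeling off one variable at a time (`entropy_pi_le_sum`). For the converses,
two-point spaces and their products turn (f), (g), (i) into convexity of `F_t` and (h) into
convexity of `D`.

Derivatives exist only at positive definite matrices. Semidefinite arguments are reached by adding
`s • 1`, or by moving towards `1`, and letting `s` tend to `0`. -/

noncomputable section

open Filter Topology

variable {d : ℕ}

/-! ### Quadratic forms of Hermitian matrices and the Löwner order -/

/-- The quadratic form `A ↦ v* A v` as a continuous linear functional. -/
def quadForm (v : Fin d → ℂ) : HermMat d →L[ℝ] ℝ :=
  LinearMap.toContinuousLinearMap
    { toFun := fun A => (star v ⬝ᵥ ((A : Matrix (Fin d) (Fin d) ℂ).mulVec v)).re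
      map_add' := fun A B => by simp [Matrix.add_mulVec, dotProduct_add]
      map_smul' := fun c A => by simp [Matrix.smul_mulVec, dotProduct_smul] }

theorem quadForm_apply (v : Fin d → ℂ) (A : HermMat d) :
    quadForm v A = (star v ⬝ᵥ ((A : Matrix (Fin d) (Fin d) ℂ).mulVec v)).re := rfl

theorem HermMat.im_dotProduct_mulVec (A : HermMat d) (v : Fin d → ℂ) :
    (star v ⬝ᵥ ((A : Matrix (Fin d) (Fin d) ℂ).mulVec v)).im = 0 := by
  have h : (A : Matrix (Fin d) (Fin d) ℂ).IsHermitian := A.2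
  exact h.im_star_dotProduct_mulVec_self v

theorem HermMat.nonneg_iff_quadForm {A : HermMat d} : 0 ≤ A ↔ ∀ v, 0 ≤ quadForm v A := by
  rw [HermMat.le_iff, Matrix.posSemidef_iff_dotProduct_mulVec]
  simp only [ZeroMemClass.coe_zero, sub_zero]
  constructor
  · exact fun h v => (Complex.le_def.1 (h.2 v)).1
  · exact fun h => ⟨A.2, fun v => Complex.le_def.2 ⟨h v, (A.im_dotProduct_mulVec v).symm⟩⟩

theorem HermMat.le_iff_quadForm {A B : HermMat d} :
    A ≤ B ↔ ∀ v, quadForm v A ≤ quadForm v B := by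
  rw [← sub_nonneg, HermMat.nonneg_iff_quadForm]
  simp

theorem posDefH_iff_quadForm {A : HermMat d} :
    PosDefH A ↔ ∀ v, v ≠ 0 → 0 < quadForm v A := by
  rw [PosDefH, Matrix.posDef_iff_dotProduct_mulVec]
  constructor
  · exact fun h v hv => (Complex.lt_def.1 (h.2 hv)).1
  · exact fun h => ⟨A.2, fun v hv =>
      Complex.lt_def.2 ⟨h v hv, (A.im_dotProduct_mulVec v).symm⟩⟩

theorem PosDefH.nonneg {A : HermMat d} (h : PosDefH A) : 0 ≤ A := by
  rw [HermMat.nonneg_iff_quadForm]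
  intro v
  by_cases hv : v = 0
  · simp [hv, quadForm_apply]
  · exact (posDefH_iff_quadForm.1 h v hv).le

theorem PosDefH.of_le {A B : HermMat d} (h : PosDefH A) (hAB : A ≤ B) : PosDefH B :=
  posDefH_iff_quadForm.2 fun v hv =>
    (posDefH_iff_quadForm.1 h v hv).trans_le (HermMat.le_iff_quadForm.1 hAB v)

theorem PosDefH.smul {A : HermMat d} (h : PosDefH A) {c : ℝ} (hc : 0 < c) : PosDefH (c • A) := by
  rw [posDefH_iff_quadForm] at *
  intro v hv
  simpa using mul_pos hc (h v hv)

theorem HermMat.smul_nonneg {A : HermMat d} (h : 0 ≤ A) {c : ℝ} (hc : 0 ≤ c) : 0 ≤ c • A := by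
  rw [HermMat.nonneg_iff_quadForm] at *
  intro v
  simpa using mul_nonneg hc (h v)

theorem PosDefH.add_nonneg {A B : HermMat d} (h : PosDefH A) (hB : 0 ≤ B) : PosDefH (A + B) :=
  h.of_le (le_add_of_nonneg_right hB)

theorem posDefH_one : PosDefH (1 : HermMat d) := Matrix.PosDef.one

theorem convex_posDefH : Convex ℝ {A : HermMat d | PosDefH A} := by
  intro A hA B hB a b ha hb hab
  rcases ha.eq_or_lt with rfl | ha
  · obtain rfl : b = 1 := by linarith
    simpa using hB
  · exact (PosDefH.smul hA ha).add_nonneg (HermMat.smul_nonneg (PosDefH.nonneg hB) hb)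

theorem convex_nonneg_hermMat : Convex ℝ {A : HermMat d | 0 ≤ A} := by
  intro A hA B hB a b ha hb hab
  exact add_nonneg (HermMat.smul_nonneg hA ha) (HermMat.smul_nonneg hB hb)

theorem isClosed_nonneg_hermMat : IsClosed {A : HermMat d | 0 ≤ A} := isClosed_Ici

theorem HermMat.neg_norm_smul_one_le (A : HermMat d) : -(‖A‖ • (1 : HermMat d)) ≤ A := by
  have h := IsSelfAdjoint.neg_algebraMap_norm_le_self (a := (A : Matrix (Fin d) (Fin d) ℂ)) A.2
  rw [← Subtype.coe_le_coe]
  simpa [Algebra.algebraMap_eq_smul_one] using h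

theorem PosDefH.exists_smul_one_le {A : HermMat d} (h : PosDefH A) :
    ∃ c : ℝ, 0 < c ∧ c • (1 : HermMat d) ≤ A := by
  rcases subsingleton_or_nontrivial (Matrix (Fin d) (Fin d) ℂ) with hs | hs
  · exact ⟨1, one_pos, (Subsingleton.elim _ _ : _ = A).le⟩
  · have h0 : (0 : Matrix (Fin d) (Fin d) ℂ) ≤ A := h.nonneg
    have hp : ∀ x ∈ spectrum ℝ (A : Matrix (Fin d) (Fin d) ℂ), 0 < x := by
      intro x hx
      refine lt_of_le_of_ne (spectrum_nonneg_of_nonneg h0 hx) ?_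
      rintro rfl
      exact spectrum.zero_notMem ℝ (Matrix.PosDef.isUnit h) hx
    obtain ⟨r, hr, hle⟩ := (CFC.exists_pos_algebraMap_le_iff A.2).2 hp
    refine ⟨r, hr, ?_⟩
    rw [← Subtype.coe_le_coe]
    simpa [Algebra.algebraMap_eq_smul_one] using hle

/-- A positive definite matrix dominates some `c • 1` with `c > 0`, and a perturbation of norm less
than `c` cannot use up this margin. -/
theorem isOpen_posDefH : IsOpen {A : HermMat d | PosDefH A} := by
  rw [Metric.isOpen_iff]
  intro A hA
  obtain ⟨c, hc, hle⟩ := PosDefH.exists_smul_one_le hA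
  refine ⟨c, hc, fun B hB => ?_⟩
  have hB' : ‖B - A‖ < c := by simpa [dist_eq_norm] using hB
  have h1 := HermMat.neg_norm_smul_one_le (B - A)
  refine (posDefH_one.smul (sub_pos.2 hB')).of_le ?_
  rw [sub_smul]
  calc c • (1 : HermMat d) - ‖B - A‖ • 1 ≤ A + (B - A) := by
        rw [sub_eq_add_neg]
        exact add_le_add hle h1
    _ = B := by abel

theorem HermMat.norm_le_of_nonneg_of_le {A B : HermMat d} (hA : 0 ≤ A) (hAB : A ≤ B) :
    ‖A‖ ≤ ‖B‖ :=
  CStarAlgebra.norm_le_norm_of_nonneg_of_le (a := (A : Matrix (Fin d) (Fin d) ℂ))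
    (b := (B : Matrix (Fin d) (Fin d) ℂ)) hA hAB

/-- Order bounds give norm bounds; all integrability and domination arguments below rest on this. -/
theorem HermMat.norm_le_of_le_of_le {A B C : HermMat d} (h1 : A ≤ B) (h2 : B ≤ C) :
    ‖B‖ ≤ 2 * ‖A‖ + ‖C‖ := by
  have h := HermMat.norm_le_of_nonneg_of_le (sub_nonneg.2 h1) (sub_le_sub_right h2 A)
  have h3 : ‖B‖ ≤ ‖B - A‖ + ‖A‖ := by simpa using norm_add_le (B - A) A
  have h4 := norm_sub_le C A
  linarith

/-! ### Convexity in the Löwner order, through quadratic forms -/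

/-- Reduces Löwner convexity to real-valued convexity, one vector at a time, so that monotonicity,
limits and Jensen's inequality can be used for real functions. -/
theorem convexOn_iff_quadForm {E : Type*} [AddCommGroup E] [Module ℝ E] {s : Set E}
    {g : E → HermMat d} :
    ConvexOn ℝ s g ↔ Convex ℝ s ∧ ∀ v, ConvexOn ℝ s (fun x => quadForm v (g x)) := by
  constructor
  · rintro ⟨hs, h⟩
    refine ⟨hs, fun v => ⟨hs, fun x hx y hy a b ha hb hab => ?_⟩⟩
    simpa using HermMat.le_iff_quadForm.1 (h hx hy ha hb hab) v
  · rintro ⟨hs, h⟩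
    refine ⟨hs, fun x hx y hy a b ha hb hab => HermMat.le_iff_quadForm.2 fun v => ?_⟩
    simpa using (h v).2 hx hy ha hb hab

theorem convex_pairsPD : Convex ℝ (pairsPD d) :=
  convex_posDefH.linear_preimage (LinearMap.fst ℝ (HermMat d) (HermMat d))

theorem convex_pairsPDAdd : Convex ℝ (pairsPDAdd d) :=
  convex_pairsPD.inter
    (convex_posDefH.linear_preimage
      (LinearMap.fst ℝ (HermMat d) (HermMat d) + LinearMap.snd ℝ (HermMat d) (HermMat d)))

theorem convex_pairsPSD : Convex ℝ (pairsPSD d) :=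
  (convex_nonneg_hermMat.linear_preimage (LinearMap.fst ℝ (HermMat d) (HermMat d))).inter
    (convex_nonneg_hermMat.linear_preimage (LinearMap.snd ℝ (HermMat d) (HermMat d)))

theorem isClosed_pairsPSD : IsClosed (pairsPSD d) :=
  (isClosed_nonneg_hermMat.preimage continuous_fst).inter
    (isClosed_nonneg_hermMat.preimage continuous_snd)

/-! ### The matrix function -/

theorem matFun_congr {Φ Ψ : ℝ → ℝ} (h : ∀ x, 0 ≤ x → Φ x = Ψ x) {A : HermMat d} (hA : 0 ≤ A) :
    matFun Φ A = matFun Ψ A := by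
  have h0 : (0 : Matrix (Fin d) (Fin d) ℂ) ≤ A := hA
  exact Subtype.ext (cfc_congr fun x hx => h x (spectrum_nonneg_of_nonneg h0 hx))

theorem continuous_matFun {Φ : ℝ → ℝ} (hΦ : Continuous Φ) :
    Continuous (matFun Φ : HermMat d → HermMat d) := by
  refine Continuous.subtype_mk ?_ _
  exact Continuous.cfc_of_mem_nhdsSet (s := Set.univ) Φ (by simp) continuous_subtype_val
    (fun A => A.2) hΦ.continuousOn

/-- The matrix function of a function that is continuous on `[0, ∞)` has a continuous extension
from the positive semidefinite cone to all Hermitian matrices. -/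
theorem exists_continuous_eq_matFun {Φ : ℝ → ℝ} (hΦ : ContinuousOn Φ (Ici 0)) (d : ℕ) :
    ∃ F : HermMat d → HermMat d, Continuous F ∧ ∀ A, 0 ≤ A → F A = matFun Φ A := by
  refine ⟨matFun fun x => Φ (max x 0), continuous_matFun ?_, fun A hA =>
    matFun_congr (fun x hx => by simp [hx]) hA⟩
  exact hΦ.comp_continuous (by fun_prop) fun x => le_max_right x 0

theorem continuousOn_matFun {Φ : ℝ → ℝ} (hΦ : ContinuousOn Φ (Ici 0)) :
    ContinuousOn (matFun Φ) {A : HermMat d | 0 ≤ A} := by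
  obtain ⟨F, hF, h⟩ := exists_continuous_eq_matFun hΦ d
  exact hF.continuousOn.congr fun A hA => (h A hA).symm

theorem stronglyMeasurable_matFun_comp {Φ : ℝ → ℝ} (hΦ : ContinuousOn Φ (Ici 0)) {Ω : Type*}
    [MeasurableSpace Ω] {Z : Ω → HermMat d} (hZ : StronglyMeasurable Z) (h0 : ∀ ω, 0 ≤ Z ω) :
    StronglyMeasurable fun ω => matFun Φ (Z ω) := by
  obtain ⟨F, hF, h⟩ := exists_continuous_eq_matFun hΦ d
  simpa only [h _ (h0 _)] using hF.comp_stronglyMeasurable hZ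

theorem aestronglyMeasurable_matFun_comp {Φ : ℝ → ℝ} (hΦ : ContinuousOn Φ (Ici 0)) {Ω : Type*}
    [MeasurableSpace Ω] {P : Measure Ω} {Z : Ω → HermMat d} (hZ : AEStronglyMeasurable Z P)
    (h0 : ∀ ω, 0 ≤ Z ω) :
    AEStronglyMeasurable (fun ω => matFun Φ (Z ω)) P := by
  obtain ⟨F, hF, h⟩ := exists_continuous_eq_matFun hΦ d
  simpa only [h _ (h0 _)] using hF.comp_aestronglyMeasurable hZ

/-- The spectrum is finite, so every function is continuous on it and the functional calculus is
linear without regularity assumptions. -/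
theorem matFun_linear_comb (Φ Ψ : ℝ → ℝ) (a b : ℝ) (A : HermMat d) :
    matFun (a • Φ + b • Ψ) A = a • matFun Φ A + b • matFun Ψ A := by
  have hc : ∀ f : ℝ → ℝ, ContinuousOn f (spectrum ℝ (A : Matrix (Fin d) (Fin d) ℂ)) :=
    fun f => (Matrix.finite_real_spectrum (A := (A : Matrix (Fin d) (Fin d) ℂ))).continuousOn f
  refine Subtype.ext ?_
  change cfc (fun x => (a • Φ) x + (b • Ψ) x) (A : Matrix (Fin d) (Fin d) ℂ) =
    a • cfc Φ (A : Matrix (Fin d) (Fin d) ℂ) + b • cfc Ψ (A : Matrix (Fin d) (Fin d) ℂ)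
  rw [cfc_add _ _ _ (hc _) (hc _)]
  congr 1
  · exact cfc_smul a Φ _ (hc _)
  · exact cfc_smul b Ψ _ (hc _)

/-! ### Derivatives along segments -/

theorem hasDerivAt_quadForm_matFun_line {Φ : ℝ → ℝ} (hΦ : TwiceFrechetDiff Φ d) (v : Fin d → ℂ)
    {A B : HermMat d} {s : ℝ} (h : PosDefH (A + s • B)) :
    HasDerivAt (fun s : ℝ => quadForm v (matFun Φ (A + s • B)))
      (quadForm v (dMat Φ (A + s • B) B)) s := by
  have hl : HasDerivAt (fun s : ℝ => A + s • B) B s := by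
    simpa using ((hasDerivAt_id s).smul_const B).const_add A
  have h1 := (hΦ _ h).1.hasFDerivAt.comp_hasDerivAt s hl
  exact (quadForm v).hasFDerivAt.comp_hasDerivAt s h1

theorem hasDerivAt_quadForm_dMat_line {Φ : ℝ → ℝ} (hΦ : TwiceFrechetDiff Φ d) (v : Fin d → ℂ)
    {A B : HermMat d} {s : ℝ} (h : PosDefH (A + s • B)) :
    HasDerivAt (fun s : ℝ => quadForm v (dMat Φ (A + s • B) B))
      (quadForm v (d2Mat Φ (A + s • B) B B)) s := by
  have hl : HasDerivAt (fun s : ℝ => A + s • B) B s := by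
    simpa using ((hasDerivAt_id s).smul_const B).const_add A
  have h1 := HasFDerivAt.comp_hasDerivAt (E := HermMat d →L[ℝ] HermMat d)
    (l := fderiv ℝ (matFun Φ (d := d))) (f := fun s : ℝ => A + s • B) s (hΦ _ h).2.hasFDerivAt hl
  have h2 := h1.clm_apply (hasDerivAt_const s B)
  have h3 := (quadForm v).hasFDerivAt.comp_hasDerivAt s h2
  refine h3.congr_deriv ?_
  simp [d2Mat]

theorem dMat_smul (Φ : ℝ → ℝ) (A B : HermMat d) (c : ℝ) : dMat Φ A (c • B) = c • dMat Φ A B :=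
  map_smul _ _ _

theorem dMat_add (Φ : ℝ → ℝ) (A B C : HermMat d) :
    dMat Φ A (B + C) = dMat Φ A B + dMat Φ A C :=
  map_add _ _ _

theorem dMat_sub (Φ : ℝ → ℝ) (A B C : HermMat d) :
    dMat Φ A (B - C) = dMat Φ A B - dMat Φ A C :=
  map_sub _ _ _

theorem dMat_neg (Φ : ℝ → ℝ) (A B : HermMat d) : dMat Φ A (-B) = -dMat Φ A B :=
  map_neg _ _

theorem dMat_zero (Φ : ℝ → ℝ) (A : HermMat d) : dMat Φ A 0 = 0 :=
  map_zero _

theorem PosDefH.add_smul_mem {A B : HermMat d} (hA : PosDefH A) (hAB : PosDefH (A + B)) {s : ℝ}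
    (h0 : 0 ≤ s) (h1 : s ≤ 1) : PosDefH (A + s • B) := by
  have := convex_posDefH hA hAB (sub_nonneg.2 h1) h0 (by ring)
  convert! this using 1
  module

theorem PosDefH.eventually_add_smul {A : HermMat d} (hA : PosDefH A) (B : HermMat d) :
    ∀ᶠ s : ℝ in 𝓝 0, PosDefH (A + s • B) := by
  have hc : ContinuousAt (fun s : ℝ => A + s • B) 0 := by fun_prop
  exact hc.eventually (isOpen_posDefH.mem_nhds (by simpa using hA))

theorem mem_pairsPDAdd_smul {p : HermMat d × HermMat d} (hp : p ∈ pairsPDAdd d) {s : ℝ}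
    (h0 : 0 ≤ s) (h1 : s ≤ 1) : (p.1, s • p.2) ∈ pairsPDAdd d :=
  ⟨hp.1, PosDefH.add_smul_mem hp.1 hp.2 h0 h1⟩

/-! ### Equivalence of the convexity properties of the matrix function -/

/-- The function is the integral over `s ∈ [0, 1]` of `d2Mat Φ (A + s • B) B B`. In place of the
integral, the convexity defect `k` of `dMat Φ (A + s • B) B` is shown to be nondecreasing in `s`;
the claim is `k 0 ≤ k 1`. -/
theorem convexOn_dMat_sub_of_d2Mat {Φ : ℝ → ℝ} (hΦ : TwiceFrechetDiff Φ d)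
    (h : SecondDerivConvex Φ d) :
    ConvexOn ℝ (pairsPDAdd d) (fun p => dMat Φ (p.1 + p.2) p.2 - dMat Φ p.1 p.2) := by
  refine convexOn_iff_quadForm.2 ⟨convex_pairsPDAdd, fun v => ⟨convex_pairsPDAdd, ?_⟩⟩
  intro p hp q hq a b ha hb hab
  have hr := convex_pairsPDAdd hp hq ha hb hab
  set r := a • p + b • q with hr_def
  let k : ℝ → ℝ := fun s => a * quadForm v (dMat Φ (p.1 + s • p.2) p.2) +
    b * quadForm v (dMat Φ (q.1 + s • q.2) q.2) - quadForm v (dMat Φ (r.1 + s • r.2) r.2)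
  have hk : ∀ s ∈ Icc (0 : ℝ) 1, HasDerivAt k
      (a * quadForm v (d2Mat Φ (p.1 + s • p.2) p.2 p.2) +
        b * quadForm v (d2Mat Φ (q.1 + s • q.2) q.2 q.2) -
        quadForm v (d2Mat Φ (r.1 + s • r.2) r.2 r.2)) s := fun s hs =>
    (((hasDerivAt_quadForm_dMat_line hΦ v (PosDefH.add_smul_mem hp.1 hp.2 hs.1 hs.2)).const_mul
      a).add ((hasDerivAt_quadForm_dMat_line hΦ v
        (PosDefH.add_smul_mem hq.1 hq.2 hs.1 hs.2)).const_mul b)).sub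
      (hasDerivAt_quadForm_dMat_line hΦ v (PosDefH.add_smul_mem hr.1 hr.2 hs.1 hs.2))
  have hmono : MonotoneOn k (Icc 0 1) := by
    refine monotoneOn_of_deriv_nonneg (convex_Icc 0 1)
      (fun s hs => (hk s hs).continuousAt.continuousWithinAt)
      (fun s hs => (hk s (interior_subset hs)).differentiableAt.differentiableWithinAt) ?_
    intro s hs
    have hs' := interior_subset hs
    rw [(hk s hs').deriv]
    have hc := ((convexOn_iff_quadForm.1 h).2 v).2
      (x := (p.1 + s • p.2, p.2)) (PosDefH.add_smul_mem hp.1 hp.2 hs'.1 hs'.2)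
      (y := (q.1 + s • q.2, q.2)) (PosDefH.add_smul_mem hq.1 hq.2 hs'.1 hs'.2) ha hb hab
    -- The map `(A, B) ↦ (A + s • B, B)` is linear, so it carries the convex combination to the
    -- convex combination.
    have he : a • (p.1 + s • p.2, p.2) + b • (q.1 + s • q.2, q.2) = (r.1 + s • r.2, r.2) := by
      ext1
      · simp only [hr_def, Prod.fst_add, Prod.smul_fst, Prod.snd_add, Prod.smul_snd]
        module
      · rfl
    rw [he] at hc
    simpa using hc
  have h01 := hmono (left_mem_Icc.2 zero_le_one) (right_mem_Icc.2 zero_le_one) zero_le_one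
  simp only [k, zero_smul, add_zero, one_smul] at h01
  simp only [map_sub, smul_eq_mul]
  linarith

/-- The derivative of `bregman Φ A (s • B)` in `s` is `dMat Φ (A + s • B) B - dMat Φ A B`, whose
convexity defect is nonnegative for `s > 0`; the divergence itself vanishes at `s = 0`. -/
theorem convexOn_bregman_of_dMat_sub {Φ : ℝ → ℝ} (hΦ : TwiceFrechetDiff Φ d)
    (h : ConvexOn ℝ (pairsPDAdd d) (fun p => dMat Φ (p.1 + p.2) p.2 - dMat Φ p.1 p.2)) :
    ConvexOn ℝ (pairsPDAdd d) (fun p => bregman Φ p.1 p.2) := by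
  refine convexOn_iff_quadForm.2 ⟨convex_pairsPDAdd, fun v => ⟨convex_pairsPDAdd, ?_⟩⟩
  intro p hp q hq a b ha hb hab
  have hr := convex_pairsPDAdd hp hq ha hb hab
  set r := a • p + b • q with hr_def
  have hline : ∀ p ∈ pairsPDAdd d, ∀ s ∈ Icc (0 : ℝ) 1,
      HasDerivAt (fun s : ℝ => quadForm v (bregman Φ p.1 (s • p.2)))
        (quadForm v (dMat Φ (p.1 + s • p.2) p.2 - dMat Φ p.1 p.2)) s := by
    intro p hp s hs
    have h1 := hasDerivAt_quadForm_matFun_line hΦ v (PosDefH.add_smul_mem hp.1 hp.2 hs.1 hs.2)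
    have h2 := (h1.sub_const (quadForm v (matFun Φ p.1))).sub
      ((hasDerivAt_id s).mul_const (quadForm v (dMat Φ p.1 p.2)))
    refine (h2.congr_deriv ?_).congr_of_eventuallyEq (Eventually.of_forall fun t => ?_)
    · simp
    · simp [bregman, dMat_smul]
  let k : ℝ → ℝ := fun s => a * quadForm v (bregman Φ p.1 (s • p.2)) +
    b * quadForm v (bregman Φ q.1 (s • q.2)) - quadForm v (bregman Φ r.1 (s • r.2))
  have hk : ∀ s ∈ Icc (0 : ℝ) 1, HasDerivAt k _ s := fun s hs =>
    (((hline p hp s hs).const_mul a).add ((hline q hq s hs).const_mul b)).sub (hline r hr s hs)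
  have hmono : MonotoneOn k (Icc 0 1) := by
    refine monotoneOn_of_deriv_nonneg (convex_Icc 0 1)
      (fun s hs => (hk s hs).continuousAt.continuousWithinAt)
      (fun s hs => (hk s (interior_subset hs)).differentiableAt.differentiableWithinAt) ?_
    intro s hs
    have hs' := interior_subset hs
    rw [interior_Icc] at hs
    rw [(hk s hs').deriv]
    have hc := ((convexOn_iff_quadForm.1 h).2 v).2 (mem_pairsPDAdd_smul hp hs'.1 hs'.2)
      (mem_pairsPDAdd_smul hq hs'.1 hs'.2) ha hb hab
    have he : a • (p.1, s • p.2) + b • (q.1, s • q.2) = (r.1, s • r.2) := by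
      ext1
      · rfl
      · simp only [hr_def, Prod.snd_add, Prod.smul_snd]
        module
    rw [he] at hc
    simp only [dMat_smul, ← smul_sub, map_smul, smul_eq_mul] at hc
    -- The hypothesis at the pairs with second entry scaled by `s` carries an extra factor `s`,
    -- positive in the interior of the interval.
    refine le_of_mul_le_mul_left ?_ hs.1
    linarith
  have h01 := hmono (left_mem_Icc.2 zero_le_one) (right_mem_Icc.2 zero_le_one) zero_le_one
  simp only [k, zero_smul, one_smul, bregman, add_zero, dMat_zero, sub_self, map_zero,
    mul_zero] at h01
  simp only [bregman, smul_eq_mul]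
  linarith

/-- Symmetrisation: adding the divergence with the endpoints `A` and `A + B` exchanged cancels the
values of `Φ`. The exchange is the linear map `(A, B) ↦ (A + B, -B)`. -/
theorem convexOn_dMat_sub_of_bregman {Φ : ℝ → ℝ}
    (h : ConvexOn ℝ (pairsPDAdd d) (fun p => bregman Φ p.1 p.2)) :
    ConvexOn ℝ (pairsPDAdd d) (fun p => dMat Φ (p.1 + p.2) p.2 - dMat Φ p.1 p.2) := by
  rw [convexOn_iff_quadForm] at h ⊢
  refine ⟨convex_pairsPDAdd, fun v => ?_⟩
  let L : HermMat d × HermMat d →ₗ[ℝ] HermMat d × HermMat d :=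
    (LinearMap.fst ℝ _ _ + LinearMap.snd ℝ _ _).prod (-LinearMap.snd ℝ _ _)
  have h2 := (h.2 v).comp_linearMap L
  have hL : pairsPDAdd d ⊆ L ⁻¹' pairsPDAdd d := fun p hp =>
    ⟨hp.2, by simpa [L] using hp.1⟩
  refine ((h.2 v).add (h2.subset hL convex_pairsPDAdd)).congr fun p hp => ?_
  simp only [Pi.add_apply, Function.comp_apply, bregman, L, LinearMap.prod_apply,
    LinearMap.add_apply, LinearMap.fst_apply, LinearMap.snd_apply, LinearMap.neg_apply,
    Function.prod, dMat_neg, ← map_add]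
  congr 1
  simp only [add_neg_cancel_right]
  abel

/-- The function in `h` at `(A, s • B)`, divided by `s ^ 2`, tends to the second derivative, and
convexity passes to the pointwise limit. -/
theorem secondDerivConvex_of_dMat_sub {Φ : ℝ → ℝ} (hΦ : TwiceFrechetDiff Φ d)
    (h : ConvexOn ℝ (pairsPDAdd d) (fun p => dMat Φ (p.1 + p.2) p.2 - dMat Φ p.1 p.2)) :
    SecondDerivConvex Φ d := by
  refine convexOn_iff_quadForm.2 ⟨convex_pairsPD, fun v => ⟨convex_pairsPD, ?_⟩⟩
  intro p hp q hq a b ha hb hab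
  have hr := convex_pairsPD hp hq ha hb hab
  set r := a • p + b • q with hr_def
  have hlim : ∀ p ∈ pairsPD d, Tendsto (fun s : ℝ => s⁻¹ * (quadForm v (dMat Φ (p.1 + s • p.2) p.2)
      - quadForm v (dMat Φ p.1 p.2))) (𝓝[>] 0) (𝓝 (quadForm v (d2Mat Φ p.1 p.2 p.2))) := by
    intro p hp
    have h1 := hasDerivAt_quadForm_dMat_line hΦ v (A := p.1) (B := p.2) (s := 0)
      (by rw [zero_smul, add_zero]; exact hp)
    simpa using h1.tendsto_slope_zero_right
  have hmem : ∀ p ∈ pairsPD d, ∀ᶠ s : ℝ in 𝓝[>] 0, (p.1, s • p.2) ∈ pairsPDAdd d := by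
    intro p hp
    filter_upwards [nhdsWithin_le_nhds (PosDefH.eventually_add_smul hp p.2)] with s hs
    exact ⟨hp, hs⟩
  refine le_of_tendsto_of_tendsto (hlim r hr)
    (((hlim p hp).const_mul a).add ((hlim q hq).const_mul b)) ?_
  filter_upwards [hmem p hp, hmem q hq, self_mem_nhdsWithin] with s hsp hsq hs
  have hs : 0 < s := hs
  have hc := ((convexOn_iff_quadForm.1 h).2 v).2 hsp hsq ha hb hab
  have he : a • (p.1, s • p.2) + b • (q.1, s • q.2) = (r.1, s • r.2) := by
    ext1
    · rfl
    · simp only [hr_def, Prod.snd_add, Prod.smul_snd]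
      module
  rw [he] at hc
  simp only [dMat_smul, ← smul_sub, map_smul, map_sub, smul_eq_mul] at hc
  -- One factor `s` comes from the difference quotient, the other from the direction `s • B`.
  refine le_of_mul_le_mul_left ?_ (mul_pos hs hs)
  have h1 : ∀ x : ℝ, s * s * (s⁻¹ * x) = s * x := fun x => by field_simp
  have h2 : ∀ x y : ℝ, s * s * (a * (s⁻¹ * x) + b * (s⁻¹ * y)) = a * (s * x) + b * (s * y) :=
    fun x y => by field_simp
  rw [h1, h2]
  exact hc

/-- To first order in the weight `s`, the gap at `(A + B, A)` is `s` times the divergence, because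
`s (A + B) + (1 - s) A = A + s B`. -/
theorem convexOn_bregman_of_jensenGap {Φ : ℝ → ℝ} (hΦ : TwiceFrechetDiff Φ d)
    (h : ∀ t ∈ Icc (0 : ℝ) 1, ConvexOn ℝ (pairsPSD d) (fun p => jensenGap Φ t p.1 p.2)) :
    ConvexOn ℝ (pairsPDAdd d) (fun p => bregman Φ p.1 p.2) := by
  refine convexOn_iff_quadForm.2 ⟨convex_pairsPDAdd, fun v => ⟨convex_pairsPDAdd, ?_⟩⟩
  intro p hp q hq a b ha hb hab
  have hr := convex_pairsPDAdd hp hq ha hb hab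
  set r := a • p + b • q with hr_def
  have hlim : ∀ p ∈ pairsPDAdd d,
      Tendsto (fun s : ℝ => s⁻¹ * quadForm v (jensenGap Φ s (p.1 + p.2) p.1)) (𝓝[>] 0)
        (𝓝 (quadForm v (bregman Φ p.1 p.2))) := by
    intro p hp
    have h1 := (hasDerivAt_quadForm_matFun_line hΦ v (A := p.1) (B := p.2) (s := 0)
      (by simpa using hp.1)).tendsto_slope_zero_right
    have h2 := h1.const_sub (quadForm v (matFun Φ (p.1 + p.2)) - quadForm v (matFun Φ p.1))
    simp only [zero_smul, add_zero, zero_add, smul_eq_mul] at h2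
    rw [bregman, map_sub, map_sub]
    refine h2.congr' ?_
    filter_upwards [self_mem_nhdsWithin] with s hs
    have hs : 0 < s := hs
    have he : s • (p.1 + p.2) + (1 - s) • p.1 = p.1 + s • p.2 := by module
    simp only [jensenGap, he, map_sub, map_add, map_smul, smul_eq_mul]
    field_simp
    ring
  refine le_of_tendsto_of_tendsto (hlim r hr)
    (((hlim p hp).const_mul a).add ((hlim q hq).const_mul b)) ?_
  filter_upwards [Ioo_mem_nhdsGT (zero_lt_one' ℝ)] with s hs
  have hc := ((convexOn_iff_quadForm.1 (h s ⟨hs.1.le, hs.2.le⟩)).2 v).2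
    (x := (p.1 + p.2, p.1)) ⟨hp.2.nonneg, hp.1.nonneg⟩
    (y := (q.1 + q.2, q.1)) ⟨hq.2.nonneg, hq.1.nonneg⟩ ha hb hab
  have he : a • (p.1 + p.2, p.1) + b • (q.1 + q.2, q.1) = (r.1 + r.2, r.1) := by
    ext1
    · simp only [hr_def, Prod.fst_add, Prod.smul_fst, Prod.snd_add, Prod.smul_snd]
      module
    · rfl
  rw [he] at hc
  simp only [smul_eq_mul] at hc
  refine le_of_mul_le_mul_left ?_ hs.1
  have h1 : ∀ x : ℝ, s * (s⁻¹ * x) = x := fun x => by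
    have := hs.1
    field_simp
  have h2 : ∀ x y : ℝ, s * (a * (s⁻¹ * x) + b * (s⁻¹ * y)) = a * x + b * y :=
    fun x y => by
      have := hs.1
      field_simp
  rw [h1, h2]
  exact hc

theorem continuousOn_jensenGap {Φ : ℝ → ℝ} (hΦ : ContinuousOn Φ (Ici 0)) {t : ℝ}
    (ht : t ∈ Icc (0 : ℝ) 1) :
    ContinuousOn (fun p : HermMat d × HermMat d => jensenGap Φ t p.1 p.2) (pairsPSD d) := by
  have h := continuousOn_matFun (d := d) hΦ
  refine (((h.comp continuousOn_fst fun p hp => hp.1).const_smul t).add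
    ((h.comp continuousOn_snd fun p hp => hp.2).const_smul (1 - t))).sub
    (h.comp (f := fun p : HermMat d × HermMat d => t • p.1 + (1 - t) • p.2)
      (by fun_prop) fun p hp => ?_)
  exact convex_nonneg_hermMat hp.1 hp.2 ht.1 (sub_nonneg.2 ht.2) (by ring)

/-- The deviations from the mean have weighted sum zero, so the derivative terms cancel. -/
theorem jensenGap_eq_bregman (Φ : ℝ → ℝ) (t : ℝ) (A B : HermMat d) :
    jensenGap Φ t A B =
      t • bregman Φ (t • A + (1 - t) • B) (A - (t • A + (1 - t) • B)) +
      (1 - t) • bregman Φ (t • A + (1 - t) • B) (B - (t • A + (1 - t) • B)) := by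
  simp only [jensenGap, bregman, add_sub_cancel, dMat_sub, dMat_add, dMat_smul]
  module

theorem convexOn_jensenGap_posDef {Φ : ℝ → ℝ}
    (h : ConvexOn ℝ (pairsPDAdd d) (fun p => bregman Φ p.1 p.2)) {t : ℝ}
    (ht : t ∈ Icc (0 : ℝ) 1) :
    ConvexOn ℝ {p : HermMat d × HermMat d | PosDefH p.1 ∧ PosDefH p.2}
      (fun p => jensenGap Φ t p.1 p.2) := by
  have hconv : Convex ℝ {p : HermMat d × HermMat d | PosDefH p.1 ∧ PosDefH p.2} :=
    (convex_posDefH.linear_preimage (LinearMap.fst ℝ (HermMat d) (HermMat d))).inter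
      (convex_posDefH.linear_preimage (LinearMap.snd ℝ (HermMat d) (HermMat d)))
  rw [convexOn_iff_quadForm] at h ⊢
  refine ⟨hconv, fun v => ?_⟩
  let C : HermMat d × HermMat d →ₗ[ℝ] HermMat d :=
    t • LinearMap.fst ℝ _ _ + (1 - t) • LinearMap.snd ℝ _ _
  have h1 := (h.2 v).comp_linearMap (C.prod (LinearMap.fst ℝ _ _ - C))
  have h2 := (h.2 v).comp_linearMap (C.prod (LinearMap.snd ℝ _ _ - C))
  have hC : ∀ p : HermMat d × HermMat d, PosDefH p.1 ∧ PosDefH p.2 →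
      PosDefH (t • p.1 + (1 - t) • p.2) := fun p hp =>
    convex_posDefH hp.1 hp.2 ht.1 (sub_nonneg.2 ht.2) (by ring)
  have h3 := (h1.subset (fun p hp => ⟨hC p hp, by simpa [C] using hp.1⟩) hconv).smul ht.1
  have h4 := (h2.subset (fun p hp => ⟨hC p hp, by simpa [C] using hp.2⟩) hconv).smul
    (sub_nonneg.2 ht.2)
  refine (h3.add h4).congr fun p hp => ?_
  change t * quadForm v (bregman Φ (t • p.1 + (1 - t) • p.2) (p.1 - (t • p.1 + (1 - t) • p.2))) +
    (1 - t) * quadForm v (bregman Φ (t • p.1 + (1 - t) • p.2)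
      (p.2 - (t • p.1 + (1 - t) • p.2))) = quadForm v (jensenGap Φ t p.1 p.2)
  rw [jensenGap_eq_bregman]
  simp

/-- Translating both arguments by `s • 1` makes them positive definite and respects convex
combinations; continuity of `Φ` up to `0` then lets `s` tend to `0`. -/
theorem convexOn_jensenGap_of_bregman {Φ : ℝ → ℝ} (hΦ : ContinuousOn Φ (Ici 0))
    (h : ConvexOn ℝ (pairsPDAdd d) (fun p => bregman Φ p.1 p.2)) {t : ℝ}
    (ht : t ∈ Icc (0 : ℝ) 1) :
    ConvexOn ℝ (pairsPSD d) (fun p => jensenGap Φ t p.1 p.2) := by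
  have hpd := (convexOn_iff_quadForm.1 (convexOn_jensenGap_posDef h ht)).2
  refine convexOn_iff_quadForm.2 ⟨convex_pairsPSD, fun v => ⟨convex_pairsPSD, ?_⟩⟩
  intro p hp q hq a b ha hb hab
  have hr := convex_pairsPSD hp hq ha hb hab
  set r := a • p + b • q with hr_def
  have hpos : ∀ p ∈ pairsPSD d, ∀ s : ℝ, 0 < s →
      PosDefH (p + s • (1 : HermMat d × HermMat d)).1 ∧
        PosDefH (p + s • (1 : HermMat d × HermMat d)).2 := by
    intro p hp s hs
    rw [add_comm]
    exact ⟨(posDefH_one.smul hs).add_nonneg hp.1, (posDefH_one.smul hs).add_nonneg hp.2⟩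
  have hlim : ∀ p ∈ pairsPSD d, Tendsto (fun s : ℝ => quadForm v (jensenGap Φ t
      (p + s • (1 : HermMat d × HermMat d)).1 (p + s • (1 : HermMat d × HermMat d)).2)) (𝓝[>] 0)
      (𝓝 (quadForm v (jensenGap Φ t p.1 p.2))) := by
    intro p hp
    have h1 : Tendsto (fun s : ℝ => p + s • (1 : HermMat d × HermMat d)) (𝓝[>] 0)
        (𝓝[pairsPSD d] p) := by
      refine tendsto_nhdsWithin_iff.2 ⟨?_, ?_⟩
      · have : ContinuousAt (fun s : ℝ => p + s • (1 : HermMat d × HermMat d)) 0 := by fun_prop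
        simpa using this.tendsto.mono_left nhdsWithin_le_nhds
      · filter_upwards [self_mem_nhdsWithin] with s hs
        exact ⟨(hpos p hp s hs).1.nonneg, (hpos p hp s hs).2.nonneg⟩
    exact ((quadForm v).continuous.tendsto _).comp ((continuousOn_jensenGap hΦ ht p hp).tendsto.comp
      h1)
  refine le_of_tendsto_of_tendsto (hlim r hr)
    (((hlim p hp).const_mul a).add ((hlim q hq).const_mul b)) ?_
  filter_upwards [self_mem_nhdsWithin] with s hs
  have hc := (hpd v).2 (hpos p hp s hs) (hpos q hq s hs) ha hb hab
  have he : a • (p + s • (1 : HermMat d × HermMat d)) + b • (q + s • (1 : HermMat d × HermMat d))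
      = r + s • (1 : HermMat d × HermMat d) := by
    have hb' : b = 1 - a := by linarith
    rw [hr_def, hb']
    module
  rw [he] at hc
  exact hc

/-! ### Positivity of the Bregman divergence and operator convexity -/

/-- Since `bregman Φ A 0 = 0`, convexity gives `bregman Φ A (s • B) ≤ s • bregman Φ A B`. Dividing
by `s`, the left side tends to `0` by differentiability. Operator convexity of `Φ` is thus a
consequence of (b). -/
theorem bregman_nonneg {Φ : ℝ → ℝ} (hΦ : TwiceFrechetDiff Φ d)
    (h : ConvexOn ℝ (pairsPDAdd d) (fun p => bregman Φ p.1 p.2)) {A B : HermMat d}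
    (hA : PosDefH A) (hAB : PosDefH (A + B)) : 0 ≤ bregman Φ A B := by
  refine HermMat.nonneg_iff_quadForm.2 fun v => ?_
  have hlim : Tendsto (fun s : ℝ => s⁻¹ * quadForm v (bregman Φ A (s • B))) (𝓝[>] 0) (𝓝 0) := by
    have h1 := (hasDerivAt_quadForm_matFun_line hΦ v (A := A) (B := B) (s := 0)
      (by simpa using hA)).tendsto_slope_zero_right
    have h2 := h1.sub_const (quadForm v (dMat Φ A B))
    simp only [zero_smul, add_zero, zero_add, smul_eq_mul, sub_self] at h2
    refine h2.congr' ?_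
    filter_upwards [self_mem_nhdsWithin] with s hs
    have hs : 0 < s := hs
    simp only [bregman, dMat_smul, map_sub, map_smul, smul_eq_mul]
    field_simp
  refine le_of_tendsto hlim ?_
  filter_upwards [Ioo_mem_nhdsGT (zero_lt_one' ℝ)] with s hs
  have hc := ((convexOn_iff_quadForm.1 h).2 v).2 (x := (A, B)) ⟨hA, hAB⟩
    (y := (A, 0)) ⟨hA, by simpa using hA⟩ hs.1.le (sub_nonneg.2 hs.2.le) (by ring)
  have he : s • (A, B) + (1 - s) • (A, (0 : HermMat d)) = (A, s • B) := by
    ext1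
    · simp only [Prod.fst_add, Prod.smul_fst]
      module
    · simp
  have h0 : bregman Φ A 0 = 0 := by simp [bregman, dMat_zero]
  rw [he] at hc
  simp only [h0, map_zero, smul_eq_mul, mul_zero, add_zero] at hc
  rw [inv_mul_le_iff₀ hs.1]
  exact hc

/-- The matrix function lies above its tangents at positive definite matrices. -/
theorem matFun_tangent_le {Φ : ℝ → ℝ} (hΦ : TwiceFrechetDiff Φ d) (hcont : ContinuousOn Φ (Ici 0))
    (h : ConvexOn ℝ (pairsPDAdd d) (fun p => bregman Φ p.1 p.2)) {A B : HermMat d}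
    (hA : PosDefH A) (hB : 0 ≤ B) : matFun Φ A + dMat Φ A (B - A) ≤ matFun Φ B := by
  have hpos : ∀ s : ℝ, 0 < s → PosDefH (B + s • (1 : HermMat d)) := fun s hs => by
    rw [add_comm]
    exact (posDefH_one.smul hs).add_nonneg hB
  have h1 : Tendsto (fun s : ℝ => B + s • (1 : HermMat d)) (𝓝[>] 0) (𝓝[{A | 0 ≤ A}] B) := by
    refine tendsto_nhdsWithin_iff.2 ⟨?_, ?_⟩
    · have : ContinuousAt (fun s : ℝ => B + s • (1 : HermMat d)) 0 := by fun_prop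
      simpa using this.tendsto.mono_left nhdsWithin_le_nhds
    · filter_upwards [self_mem_nhdsWithin] with s hs
      exact (hpos s hs).nonneg
  have h2 := (continuousOn_matFun hcont B hB).tendsto.comp h1
  have h3 : Tendsto (fun s : ℝ => matFun Φ A + dMat Φ A (B + s • 1 - A)) (𝓝[>] 0)
      (𝓝 (matFun Φ A + dMat Φ A (B - A))) := by
    have h4 : Continuous fun X : HermMat d => matFun Φ A + dMat Φ A (X - A) :=
      continuous_const.add
        ((fderiv ℝ (matFun Φ) A).continuous.comp (continuous_id.sub continuous_const))
    exact (h4.tendsto B).comp (h1.mono_right nhdsWithin_le_nhds)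
  refine le_of_tendsto_of_tendsto h3 h2 ?_
  filter_upwards [self_mem_nhdsWithin] with s hs
  have hn := bregman_nonneg hΦ h hA (B := B + s • 1 - A) (by simpa using hpos s hs)
  rw [bregman, add_sub_cancel, sub_sub, sub_nonneg] at hn
  exact hn

theorem jensenGap_nonneg {Φ : ℝ → ℝ} (hΦ : TwiceFrechetDiff Φ d) (hcont : ContinuousOn Φ (Ici 0))
    (h : ConvexOn ℝ (pairsPDAdd d) (fun p => bregman Φ p.1 p.2)) {A B : HermMat d}
    (hA : 0 ≤ A) (hB : 0 ≤ B) {t : ℝ} (ht : t ∈ Icc (0 : ℝ) 1) : 0 ≤ jensenGap Φ t A B := by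
  have hpos : ∀ s : ℝ, 0 < s →
      PosDefH ((A, B) + s • (1 : HermMat d × HermMat d)).1 ∧
        PosDefH ((A, B) + s • (1 : HermMat d × HermMat d)).2 := by
    intro s hs
    rw [add_comm]
    exact ⟨(posDefH_one.smul hs).add_nonneg hA, (posDefH_one.smul hs).add_nonneg hB⟩
  have h1 : Tendsto (fun s : ℝ => (A, B) + s • (1 : HermMat d × HermMat d)) (𝓝[>] 0)
      (𝓝[pairsPSD d] (A, B)) := by
    refine tendsto_nhdsWithin_iff.2 ⟨?_, ?_⟩
    · have : ContinuousAt (fun s : ℝ => (A, B) + s • (1 : HermMat d × HermMat d)) 0 := by fun_prop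
      simpa using this.tendsto.mono_left nhdsWithin_le_nhds
    · filter_upwards [self_mem_nhdsWithin] with s hs
      exact ⟨(hpos s hs).1.nonneg, (hpos s hs).2.nonneg⟩
  refine ge_of_tendsto ((continuousOn_jensenGap hcont ht (A, B) ⟨hA, hB⟩).tendsto.comp h1) ?_
  filter_upwards [self_mem_nhdsWithin] with s hs
  have hC := convex_posDefH (hpos s hs).1 (hpos s hs).2 ht.1 (sub_nonneg.2 ht.2) (by ring)
  simp only [Function.comp_apply]
  rw [jensenGap_eq_bregman]
  refine add_nonneg (HermMat.smul_nonneg (bregman_nonneg hΦ h hC ?_) ht.1)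
    (HermMat.smul_nonneg (bregman_nonneg hΦ h hC ?_) (sub_nonneg.2 ht.2))
  · simpa using (hpos s hs).1
  · simpa using (hpos s hs).2

theorem convexOn_matFun {Φ : ℝ → ℝ} (hΦ : TwiceFrechetDiff Φ d) (hcont : ContinuousOn Φ (Ici 0))
    (h : ConvexOn ℝ (pairsPDAdd d) (fun p => bregman Φ p.1 p.2)) :
    ConvexOn ℝ {A : HermMat d | 0 ≤ A} (matFun Φ) := by
  refine ⟨convex_nonneg_hermMat, fun A hA B hB a b ha hb hab => ?_⟩
  obtain rfl : b = 1 - a := by linarith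
  have := jensenGap_nonneg hΦ hcont h hA hB (t := a) ⟨ha, by linarith⟩
  rwa [jensenGap, sub_nonneg] at this

/-! ### Bochner integrals of Hermitian matrices -/

section Integrals

variable {Ω : Type*} [MeasurableSpace Ω] {P : Measure Ω}

theorem quadForm_integral (v : Fin d → ℂ) {Z : Ω → HermMat d} (hZ : Integrable Z P) :
    quadForm v (∫ ω, Z ω ∂P) = ∫ ω, quadForm v (Z ω) ∂P :=
  ((quadForm v).integral_comp_comm hZ).symm

theorem integrable_quadForm (v : Fin d → ℂ) {Z : Ω → HermMat d} (hZ : Integrable Z P) :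
    Integrable (fun ω => quadForm v (Z ω)) P :=
  (quadForm v).integrable_comp hZ

theorem HermMat.integral_nonneg {Z : Ω → HermMat d} (h : ∀ᵐ ω ∂P, 0 ≤ Z ω) :
    0 ≤ ∫ ω, Z ω ∂P := by
  by_cases hZ : Integrable Z P
  · refine HermMat.nonneg_iff_quadForm.2 fun v => ?_
    rw [quadForm_integral v hZ]
    refine integral_nonneg_of_ae ?_
    filter_upwards [h] with ω hω using HermMat.nonneg_iff_quadForm.1 hω v
  · rw [integral_undef hZ]

theorem HermMat.integral_mono {Y Z : Ω → HermMat d} (hY : Integrable Y P) (hZ : Integrable Z P)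
    (h : ∀ᵐ ω ∂P, Y ω ≤ Z ω) : ∫ ω, Y ω ∂P ≤ ∫ ω, Z ω ∂P := by
  rw [← sub_nonneg, ← integral_sub hZ hY]
  refine HermMat.integral_nonneg ?_
  filter_upwards [h] with ω hω using sub_nonneg.2 hω

theorem posDefH_integral [IsProbabilityMeasure P] {Z : Ω → HermMat d} (hZ : Integrable Z P)
    (h : ∀ᵐ ω ∂P, PosDefH (Z ω)) : PosDefH (∫ ω, Z ω ∂P) := by
  refine posDefH_iff_quadForm.2 fun v hv => ?_
  rw [quadForm_integral v hZ]
  have hpos : ∀ᵐ ω ∂P, 0 < quadForm v (Z ω) := by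
    filter_upwards [h] with ω hω using posDefH_iff_quadForm.1 hω v hv
  have h0 : 0 ≤ᵐ[P] fun ω => quadForm v (Z ω) := hpos.mono fun ω hω => hω.le
  refine lt_of_le_of_ne (integral_nonneg_of_ae h0) fun he => ?_
  have hz := (integral_eq_zero_iff_of_nonneg_ae h0 (integrable_quadForm v hZ)).1 he.symm
  obtain ⟨ω, h1, h2⟩ := (hpos.and hz).exists
  exact h1.ne' h2

theorem integrable_of_le_of_le {L Z U : Ω → HermMat d} (hL : Integrable L P) (hU : Integrable U P)
    (hZ : AEStronglyMeasurable Z P) (h1 : ∀ᵐ ω ∂P, L ω ≤ Z ω) (h2 : ∀ᵐ ω ∂P, Z ω ≤ U ω) :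
    Integrable Z P := by
  refine ((hL.norm.const_mul 2).add hU.norm).mono' hZ ?_
  filter_upwards [h1, h2] with ω h1 h2 using HermMat.norm_le_of_le_of_le h1 h2

/-- Jensen's inequality for functions with values in the Hermitian matrices that are convex and
continuous on a closed set. -/
theorem ConvexOn.hermMat_map_integral_le [IsProbabilityMeasure P] {E : Type*}
    [NormedAddCommGroup E] [NormedSpace ℝ E] [CompleteSpace E] {s : Set E} {g : E → HermMat d}
    (hg : ConvexOn ℝ s g) (hc : ContinuousOn g s) (hs : IsClosed s) {f : Ω → E}
    (hfs : ∀ᵐ ω ∂P, f ω ∈ s) (hf : Integrable f P) (hgf : Integrable (fun ω => g (f ω)) P) :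
    g (∫ ω, f ω ∂P) ≤ ∫ ω, g (f ω) ∂P := by
  refine HermMat.le_iff_quadForm.2 fun v => ?_
  rw [quadForm_integral v hgf]
  exact ((convexOn_iff_quadForm.1 hg).2 v).map_integral_le
    ((quadForm v).continuous.comp_continuousOn hc) hs hfs hf (integrable_quadForm v hgf)

end Integrals

/-! ### Jensen's inequality for differentiable convex functions -/

theorem ConvexOn.add_fderiv_le {E : Type*} [NormedAddCommGroup E] [NormedSpace ℝ E] {s : Set E}
    {φ : E → ℝ} (hφ : ConvexOn ℝ s φ) {φ' : E →L[ℝ] ℝ} {x y : E} (hx : x ∈ s) (hy : y ∈ s)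
    (hd : HasFDerivAt φ φ' x) : φ x + φ' (y - x) ≤ φ y := by
  have hl : HasDerivAt (fun t : ℝ => x + t • (y - x)) (y - x) 0 := by
    simpa using ((hasDerivAt_id (0 : ℝ)).smul_const (y - x)).const_add x
  have hd' : HasFDerivAt φ φ' (x + (0 : ℝ) • (y - x)) := by simpa using hd
  have h1 := (hd'.comp_hasDerivAt (0 : ℝ) hl).tendsto_slope_zero_right
  have h2 : φ' (y - x) ≤ φ y - φ x := by
    refine le_of_tendsto h1 ?_
    filter_upwards [Ioo_mem_nhdsGT (zero_lt_one' ℝ)] with t ht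
    have hc := hφ.2 hx hy (sub_nonneg.2 ht.2.le) ht.1.le (by ring)
    have he : (1 - t) • x + t • y = x + t • (y - x) := by module
    rw [he] at hc
    simp only [Function.comp_apply, zero_add, zero_smul, add_zero, smul_eq_mul] at hc ⊢
    rw [inv_mul_le_iff₀ ht.1]
    linarith
  linarith

/-- The tangent at the mean supports the function, so `s` need not be closed. This is what
`pairsPDAdd` requires. -/
theorem ConvexOn.map_integral_le_of_hasFDerivAt {E : Type*} [NormedAddCommGroup E]
    [NormedSpace ℝ E] [CompleteSpace E] {s : Set E} {φ : E → ℝ} (hφ : ConvexOn ℝ s φ)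
    {Ω : Type*} [MeasurableSpace Ω] {P : Measure Ω} [IsProbabilityMeasure P] {f : Ω → E}
    {φ' : E →L[ℝ] ℝ} (hd : HasFDerivAt φ φ' (∫ ω, f ω ∂P)) (hm : ∫ ω, f ω ∂P ∈ s)
    (hfs : ∀ᵐ ω ∂P, f ω ∈ s) (hf : Integrable f P) (hφf : Integrable (fun ω => φ (f ω)) P) :
    φ (∫ ω, f ω ∂P) ≤ ∫ ω, φ (f ω) ∂P := by
  have hi : Integrable (fun ω => φ' (f ω - ∫ ω, f ω ∂P)) P :=
    φ'.integrable_comp (hf.sub (integrable_const _))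
  have h0 : ∫ ω, φ' (f ω - ∫ ω, f ω ∂P) ∂P = 0 := by
    have hc := φ'.integral_comp_comm (hf.sub (integrable_const (∫ ω, f ω ∂P)))
    simp only [Pi.sub_apply] at hc
    rw [hc, integral_sub hf (integrable_const _)]
    simp
  calc φ (∫ ω, f ω ∂P) = ∫ ω, (φ (∫ ω, f ω ∂P) + φ' (f ω - ∫ ω, f ω ∂P)) ∂P := by
        rw [integral_add (integrable_const _) hi, h0]
        simp
    _ ≤ ∫ ω, φ (f ω) ∂P := by
        refine integral_mono_ae ((integrable_const _).add hi) hφf ?_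
        filter_upwards [hfs] with ω hω using hφ.add_fderiv_le hm hω hd

theorem differentiableAt_quadForm_bregman {Φ : ℝ → ℝ} (hΦ : TwiceFrechetDiff Φ d) (v : Fin d → ℂ)
    {p : HermMat d × HermMat d} (hp : p ∈ pairsPDAdd d) :
    DifferentiableAt ℝ (fun p : HermMat d × HermMat d => quadForm v (bregman Φ p.1 p.2)) p := by
  have h1 : DifferentiableAt ℝ (fun p : HermMat d × HermMat d => matFun Φ (p.1 + p.2)) p :=
    DifferentiableAt.comp (g := matFun Φ) (f := fun p : HermMat d × HermMat d => p.1 + p.2) p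
      (hΦ _ hp.2).1 (by fun_prop)
  have h2 : DifferentiableAt ℝ (fun p : HermMat d × HermMat d => matFun Φ p.1) p :=
    DifferentiableAt.comp (g := matFun Φ) (f := fun p : HermMat d × HermMat d => p.1) p
      (hΦ _ hp.1).1 (by fun_prop)
  have h3 : DifferentiableAt ℝ
      (fun p : HermMat d × HermMat d => fderiv ℝ (matFun Φ (d := d)) p.1) p :=
    DifferentiableAt.comp (𝕜 := ℝ) (G := HermMat d →L[ℝ] HermMat d) (g := fderiv ℝ (matFun Φ (d := d)))
      (f := fun p : HermMat d × HermMat d => p.1) p (hΦ _ hp.1).2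
      differentiableAt_fst
  have h4 := h3.clm_apply (differentiableAt_snd (𝕜 := ℝ) (p := p))
  exact (quadForm v).differentiableAt.comp p ((h1.sub h2).sub h4)

/-- Jensen's inequality for the divergence at the pair `(T, Z - T)`. Integrability is asked of the
quadratic form only, since in the two-block argument it is obtained for each `v` separately. -/
theorem quadForm_bregman_integral_le {Φ : ℝ → ℝ} (hΦ : TwiceFrechetDiff Φ d)
    (h : ConvexOn ℝ (pairsPDAdd d) (fun p => bregman Φ p.1 p.2)) (v : Fin d → ℂ)
    {Ω : Type*} [MeasurableSpace Ω] {P : Measure Ω} [IsProbabilityMeasure P]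
    {T Z : Ω → HermMat d} (hT : ∀ᵐ ω ∂P, PosDefH (T ω)) (hZ : ∀ᵐ ω ∂P, PosDefH (Z ω))
    (hTi : Integrable T P) (hZi : Integrable Z P)
    (hB : Integrable (fun ω => quadForm v (bregman Φ (T ω) (Z ω - T ω))) P) :
    quadForm v (bregman Φ (∫ ω, T ω ∂P) (∫ ω, Z ω ∂P - ∫ ω, T ω ∂P)) ≤
      ∫ ω, quadForm v (bregman Φ (T ω) (Z ω - T ω)) ∂P := by
  have hi : ∫ ω, (T ω, Z ω - T ω) ∂P = (∫ ω, T ω ∂P, ∫ ω, Z ω ∂P - ∫ ω, T ω ∂P) := by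
    rw [← integral_sub hZi hTi]
    exact integral_pair hTi (hZi.sub hTi)
  have hm : (∫ ω, T ω ∂P, ∫ ω, Z ω ∂P - ∫ ω, T ω ∂P) ∈ pairsPDAdd d :=
    ⟨posDefH_integral hTi hT, by simpa using posDefH_integral hZi hZ⟩
  have hd := (differentiableAt_quadForm_bregman hΦ v hm).hasFDerivAt
  rw [← hi] at hm hd
  have := ((convexOn_iff_quadForm.1 h).2 v).map_integral_le_of_hasFDerivAt hd hm
    (by
      filter_upwards [hT, hZ] with ω h1 h2
      exact ⟨h1, by simpa using h2⟩) (hTi.prodMk (hZi.sub hTi)) hB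
  rwa [hi] at this

/-! ### Measurability and integrability of the matrix function along random matrices -/

/-- The directional derivative is a pointwise limit of difference quotients of the continuous
extension `F`, which agrees with the matrix function near each positive definite matrix. -/
theorem aestronglyMeasurable_dMat {Φ : ℝ → ℝ} (hΦ : TwiceFrechetDiff Φ d)
    (hcont : ContinuousOn Φ (Ici 0)) {Ω : Type*} [MeasurableSpace Ω] {P : Measure Ω}
    {T B : Ω → HermMat d} (hT : ∀ ω, PosDefH (T ω)) (hTm : AEStronglyMeasurable T P)
    (hBm : AEStronglyMeasurable B P) : AEStronglyMeasurable (fun ω => dMat Φ (T ω) (B ω)) P := by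
  obtain ⟨F, hF, h⟩ := exists_continuous_eq_matFun hcont d
  refine aestronglyMeasurable_of_tendsto_ae (ι := ℕ) atTop
    (f := fun n ω => ((n : ℝ)) • (F (T ω + ((n : ℝ))⁻¹ • B ω) - F (T ω))) (fun n => ?_)
    (Eventually.of_forall fun ω => ?_)
  · exact ((hF.comp_aestronglyMeasurable (hTm.add (hBm.const_smul ((n : ℝ))⁻¹))).sub
      (hF.comp_aestronglyMeasurable hTm)).const_smul (n : ℝ)
  · have he : F =ᶠ[𝓝 (T ω)] matFun Φ := by
      filter_upwards [isOpen_posDefH.mem_nhds (hT ω)] with A hA using h A (PosDefH.nonneg hA)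
    have hd := (hΦ _ (hT ω)).1.hasFDerivAt.congr_of_eventuallyEq he
    refine hd.lim (B ω) ?_
    simpa using tendsto_natCast_atTop_atTop (R := ℝ)

section

variable {Φ : ℝ → ℝ} {Ω : Type*} [MeasurableSpace Ω] {P : Measure Ω}

/-- Only an upper bound is needed: the tangent at `1` is an integrable lower bound. -/
theorem integrable_matFun_of_le [IsFiniteMeasure P] (hΦ : TwiceFrechetDiff Φ d)
    (hcont : ContinuousOn Φ (Ici 0)) (h : ConvexOn ℝ (pairsPDAdd d) (fun p => bregman Φ p.1 p.2))
    {Z U : Ω → HermMat d} (h0 : ∀ ω, 0 ≤ Z ω) (hZ : Integrable Z P) (hU : Integrable U P)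
    (hle : ∀ᵐ ω ∂P, matFun Φ (Z ω) ≤ U ω) : Integrable (fun ω => matFun Φ (Z ω)) P := by
  refine integrable_of_le_of_le (L := fun ω => matFun Φ 1 + dMat Φ 1 (Z ω - 1)) ?_ hU
    (aestronglyMeasurable_matFun_comp hcont hZ.1 h0)
    (Eventually.of_forall fun ω => matFun_tangent_le hΦ hcont h posDefH_one (h0 ω)) hle
  exact (integrable_const _).add
    ((fderiv ℝ (matFun Φ) 1).integrable_comp (hZ.sub (integrable_const _)))

theorem matFun_integral_le [IsProbabilityMeasure P] (hΦ : TwiceFrechetDiff Φ d)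
    (hcont : ContinuousOn Φ (Ici 0)) (h : ConvexOn ℝ (pairsPDAdd d) (fun p => bregman Φ p.1 p.2))
    {Z : Ω → HermMat d} (h0 : ∀ ω, 0 ≤ Z ω) (hZ : Integrable Z P)
    (hZΦ : Integrable (fun ω => matFun Φ (Z ω)) P) :
    matFun Φ (∫ ω, Z ω ∂P) ≤ ∫ ω, matFun Φ (Z ω) ∂P :=
  (convexOn_matFun hΦ hcont h).hermMat_map_integral_le (continuousOn_matFun hcont)
    isClosed_nonneg_hermMat (Eventually.of_forall h0) hZ hZΦ

theorem integrable_matFun_comb [IsFiniteMeasure P] (hΦ : TwiceFrechetDiff Φ d)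
    (hcont : ContinuousOn Φ (Ici 0)) (h : ConvexOn ℝ (pairsPDAdd d) (fun p => bregman Φ p.1 p.2))
    {Y Z : Ω → HermMat d} (hY0 : ∀ ω, 0 ≤ Y ω) (hZ0 : ∀ ω, 0 ≤ Z ω) (hY : Integrable Y P)
    (hZ : Integrable Z P) (hYΦ : Integrable (fun ω => matFun Φ (Y ω)) P)
    (hZΦ : Integrable (fun ω => matFun Φ (Z ω)) P) {a b : ℝ} (ha : 0 ≤ a) (hb : 0 ≤ b)
    (hab : a + b = 1) : Integrable (fun ω => matFun Φ (a • Y ω + b • Z ω)) P :=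
  integrable_matFun_of_le hΦ hcont h (fun ω => convex_nonneg_hermMat (hY0 ω) (hZ0 ω) ha hb hab)
    ((hY.smul a).add (hZ.smul b)) ((hYΦ.smul a).add (hZΦ.smul b))
    (Eventually.of_forall fun ω => (convexOn_matFun hΦ hcont h).2 (hY0 ω) (hZ0 ω) ha hb hab)

end

/-! ### Two-point probability spaces -/

/-- The measure on a two-point space with masses `a` and `b`. -/
def twoPoint (a b : ℝ) : Measure (ULift.{u} Bool) :=
  ENNReal.ofReal a • Measure.dirac ⟨true⟩ + ENNReal.ofReal b • Measure.dirac ⟨false⟩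

theorem isProbabilityMeasure_twoPoint {a b : ℝ} (ha : 0 ≤ a) (hb : 0 ≤ b) (hab : a + b = 1) :
    IsProbabilityMeasure (twoPoint.{u} a b) := by
  refine ⟨?_⟩
  simp [twoPoint, ← ENNReal.ofReal_add ha hb, hab]

instance (a b : ℝ) : IsFiniteMeasure (twoPoint.{u} a b) := by
  refine ⟨?_⟩
  simp [twoPoint]

theorem integral_twoPoint {E : Type*} [NormedAddCommGroup E] [NormedSpace ℝ E] [CompleteSpace E]
    {a b : ℝ} (ha : 0 ≤ a) (hb : 0 ≤ b) (g : ULift.{u} Bool → E) :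
    ∫ i, g i ∂(twoPoint.{u} a b) = a • g ⟨true⟩ + b • g ⟨false⟩ := by
  have hi : ∀ (c : ENNReal) (x : ULift.{u} Bool), c ≠ ⊤ → Integrable g (c • Measure.dirac x) :=
    fun c x hc => (integrable_dirac (by simp)).smul_measure hc
  rw [twoPoint, integral_add_measure (hi _ _ ENNReal.ofReal_ne_top) (hi _ _ ENNReal.ofReal_ne_top),
    integral_smul_measure, integral_smul_measure, integral_dirac, integral_dirac,
    ENNReal.toReal_ofReal ha, ENNReal.toReal_ofReal hb]

/-- The bridge from entropies back to (e). Lifting `Bool` to the universe `u` makes the two-point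
space an admissible test space. -/
theorem opEntropy_twoPoint (Φ : ℝ → ℝ) {t : ℝ} (ht : t ∈ Icc (0 : ℝ) 1)
    (Z : ULift.{u} Bool → HermMat d) :
    opEntropy Φ (twoPoint.{u} t (1 - t)) Z = jensenGap Φ t (Z ⟨true⟩) (Z ⟨false⟩) := by
  rw [opEntropy, integral_twoPoint ht.1 (sub_nonneg.2 ht.2),
    integral_twoPoint ht.1 (sub_nonneg.2 ht.2), jensenGap]

/-! ### Convexity of the entropy -/

/-- The convexity defect of the entropy at `Y`, `Z` with weights `a`, `1 - a` is the Jensen gap of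
the jointly convex function `F_a` along the random pair `(Y, Z)`. -/
theorem entropyConvex_of_bregman {Φ : ℝ → ℝ} (hΦ : IsEntropyFun Φ)
    (h : ∀ d : ℕ, ConvexOn ℝ (pairsPDAdd d) (fun p => bregman Φ p.1 p.2)) :
    EntropyConvex.{u} Φ := by
  intro d Ω _ P _
  have hconv : Convex ℝ (psdDomain Φ d P) := fun Y hY Z hZ a b ha hb hab =>
    ⟨fun ω => convex_nonneg_hermMat (hY.1 ω) (hZ.1 ω) ha hb hab,
      (hY.2.1.smul a).add (hZ.2.1.smul b),
      integrable_matFun_comb (hΦ.twiceFrechetDiff d) hΦ.continuousOn (h d) hY.1 hZ.1 hY.2.1 hZ.2.1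
        hY.2.2 hZ.2.2 ha hb hab⟩
  refine ⟨hconv, fun Y hY Z hZ a b ha hb hab => ?_⟩
  have hW := hconv hY hZ ha hb hab
  have hb' : b = 1 - a := by linarith
  have ht : a ∈ Icc (0 : ℝ) 1 := ⟨ha, by linarith⟩
  have hg : Integrable (fun ω => jensenGap Φ a (Y ω) (Z ω)) P := by
    have := ((hY.2.2.smul a).add (hZ.2.2.smul b)).sub hW.2.2
    rw [hb'] at this
    exact this
  have hJ := (convexOn_jensenGap_of_bregman hΦ.continuousOn (h d) ht).hermMat_map_integral_le
    (continuousOn_jensenGap hΦ.continuousOn ht) isClosed_pairsPSD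
    (f := fun ω => (Y ω, Z ω)) (P := P) (Eventually.of_forall fun ω => ⟨hY.1 ω, hZ.1 ω⟩)
    (hY.2.1.prodMk hZ.2.1) hg
  rw [integral_pair hY.2.1 hZ.2.1] at hJ
  have h1 : ∫ ω, jensenGap Φ a (Y ω) (Z ω) ∂P = a • ∫ ω, matFun Φ (Y ω) ∂P +
      b • ∫ ω, matFun Φ (Z ω) ∂P - ∫ ω, matFun Φ ((a • Y + b • Z) ω) ∂P := by
    have e1 : ∫ ω, (a • matFun Φ (Y ω) + b • matFun Φ (Z ω)) ∂P =
        ∫ ω, a • matFun Φ (Y ω) ∂P + ∫ ω, b • matFun Φ (Z ω) ∂P :=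
      integral_add (hY.2.2.smul a) (hZ.2.2.smul b)
    have e2 : ∫ ω, (a • matFun Φ (Y ω) + b • matFun Φ (Z ω) - matFun Φ ((a • Y + b • Z) ω)) ∂P =
        ∫ ω, (a • matFun Φ (Y ω) + b • matFun Φ (Z ω)) ∂P -
          ∫ ω, matFun Φ ((a • Y + b • Z) ω) ∂P :=
      integral_sub ((hY.2.2.smul a).add (hZ.2.2.smul b)) hW.2.2
    rw [← integral_smul, ← integral_smul, ← e1, ← e2]
    simp [jensenGap, hb']
  have h2 : ∫ ω, (a • Y + b • Z) ω ∂P = a • ∫ ω, Y ω ∂P + b • ∫ ω, Z ω ∂P := by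
    rw [← integral_smul, ← integral_smul]
    exact integral_add (hY.2.1.smul a) (hZ.2.1.smul b)
  rw [h1] at hJ
  simp only [opEntropy, h2]
  simp only [jensenGap, ← hb'] at hJ
  have := sub_nonneg.2 hJ
  rw [← sub_nonneg]
  convert! this using 1
  module

theorem convexOn_jensenGap_of_entropyConvex {Φ : ℝ → ℝ} (h : EntropyConvex.{u} Φ) (d : ℕ) {t : ℝ}
    (ht : t ∈ Icc (0 : ℝ) 1) : ConvexOn ℝ (pairsPSD d) (fun p => jensenGap Φ t p.1 p.2) := by
  have := isProbabilityMeasure_twoPoint.{u} ht.1 (sub_nonneg.2 ht.2) (by ring)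
  have hc := h d _ (twoPoint.{u} t (1 - t))
  have hmem : ∀ p ∈ pairsPSD d, (fun i : ULift.{u} Bool => bif i.down then p.1 else p.2) ∈
      psdDomain Φ d (twoPoint.{u} t (1 - t)) := fun p hp =>
    ⟨by rintro ⟨_ | _⟩; exacts [hp.2, hp.1], .of_finite, .of_finite⟩
  refine ⟨convex_pairsPSD, fun p hp q hq a b ha hb hab => ?_⟩
  simpa [opEntropy_twoPoint Φ ht] using hc.2 (hmem p hp) (hmem q hq) ha hb hab

/-! ### The supremum representation -/

theorem integral_dMat_sub {Φ : ℝ → ℝ} {Ω : Type*} [MeasurableSpace Ω] {P : Measure Ω}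
    {T Z : Ω → HermMat d} (hT : Integrable T P) (hZ : Integrable Z P) (A : HermMat d) :
    Integrable (fun ω => dMat Φ A (Z ω - T ω)) P ∧
      ∫ ω, dMat Φ A (Z ω - T ω) ∂P = dMat Φ A (∫ ω, Z ω ∂P - ∫ ω, T ω ∂P) := by
  refine ⟨(fderiv ℝ (matFun Φ) A).integrable_comp (hZ.sub hT), ?_⟩
  rw [← integral_sub hZ hT]
  exact (fderiv ℝ (matFun Φ) A).integral_comp_comm (hZ.sub hT)

theorem supRepresentation_of_bregman {Φ : ℝ → ℝ} (hΦ : IsEntropyFun Φ)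
    (h : ∀ d : ℕ, ConvexOn ℝ (pairsPDAdd d) (fun p => bregman Φ p.1 p.2)) :
    SupRepresentation.{u} Φ := by
  intro d Ω _ P _ Z hZ
  constructor
  · rintro _ ⟨T, hT, hD, rfl⟩
    refine HermMat.le_iff_quadForm.2 fun v => ?_
    have hB : Integrable (fun ω => bregman Φ (T ω) (Z ω - T ω)) P := by
      simp only [bregman, add_sub_cancel]
      exact (hZ.2.2.sub hT.2.2).sub hD
    have hJ := quadForm_bregman_integral_le (hΦ.twiceFrechetDiff d) (h d) v
      (Eventually.of_forall hT.1) (Eventually.of_forall hZ.1) hT.2.1 hZ.2.1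
      (integrable_quadForm v hB)
    rw [← quadForm_integral v hB] at hJ
    have hBi : ∫ ω, bregman Φ (T ω) (Z ω - T ω) ∂P = ∫ ω, matFun Φ (Z ω) ∂P -
        ∫ ω, matFun Φ (T ω) ∂P - ∫ ω, dMat Φ (T ω) (Z ω - T ω) ∂P := by
      rw [← integral_sub hZ.2.2 hT.2.2]
      simp only [bregman, add_sub_cancel]
      exact integral_sub (hZ.2.2.sub hT.2.2) hD
    obtain ⟨hAi, hAe⟩ := integral_dMat_sub (Φ := Φ) hT.2.1 hZ.2.1 (∫ ω, T ω ∂P)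
    rw [integral_sub hD hAi, hAe]
    rw [hBi] at hJ
    simp only [bregman, opEntropy, add_sub_cancel, map_sub, map_add] at hJ ⊢
    linarith
  · intro U hU
    -- The choice `T = Z` attains the supremum, as both derivative terms are evaluated in direction
    -- `0`.
    refine hU ⟨Z, hZ, by simp [dMat_zero], by simp [dMat_zero]⟩

/-- On the space with masses `a`, `b`, let `T` take the values `p.1`, `q.1` and `Z` the values `p.1
+ p.2`, `q.1 + q.2`. That the dual value of `T` is at most the entropy of `Z` is then the convexity
inequality. -/
theorem convexOn_bregman_of_supRepresentation {Φ : ℝ → ℝ} (h : SupRepresentation.{u} Φ) (d : ℕ) :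
    ConvexOn ℝ (pairsPDAdd d) (fun p => bregman Φ p.1 p.2) := by
  refine ⟨convex_pairsPDAdd, fun p hp q hq a b ha hb hab => ?_⟩
  have := isProbabilityMeasure_twoPoint.{u} ha hb hab
  have hmem : ∀ A B : HermMat d, PosDefH A → PosDefH B →
      (fun i : ULift.{u} Bool => bif i.down then A else B) ∈ pdDomain Φ d (twoPoint.{u} a b) :=
    fun A B hA hB => ⟨by rintro ⟨_ | _⟩; exacts [hB, hA], .of_finite, .of_finite⟩
  have hle := (h d _ (twoPoint.{u} a b) _ (hmem _ _ hp.2 hq.2)).1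
    ⟨_, hmem _ _ hp.1 hq.1, .of_finite, rfl⟩
  simp only [opEntropy, integral_twoPoint ha hb, cond_true, cond_false, add_sub_cancel_left] at hle
  simp only [bregman, Prod.fst_add, Prod.snd_add, Prod.smul_fst, Prod.smul_snd]
  have he : a • p.1 + b • q.1 + (a • p.2 + b • q.2) = a • (p.1 + p.2) + b • (q.1 + q.2) := by
    module
  rw [he, dMat_add, dMat_smul, dMat_smul]
  rw [← sub_nonneg] at hle ⊢
  convert! hle using 1
  module

/-! ### Two independent blocks of variables -/

section TwoBlocks

variable {Φ : ℝ → ℝ} {S₁ S₂ : Type*} [MeasurableSpace S₁] [MeasurableSpace S₂] {μ : Measure S₁}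
  {ν : Measure S₂} [IsProbabilityMeasure μ] [IsProbabilityMeasure ν]

theorem integrable_matFun_integral (hΦ : TwiceFrechetDiff Φ d) (hcont : ContinuousOn Φ (Ici 0))
    (h : ConvexOn ℝ (pairsPDAdd d) (fun p => bregman Φ p.1 p.2)) {f : S₁ × S₂ → HermMat d}
    (h0 : ∀ z, 0 ≤ f z) (hf : Integrable f (μ.prod ν))
    (hfΦ : Integrable (fun z => matFun Φ (f z)) (μ.prod ν)) :
    Integrable (fun x => matFun Φ (∫ y, f (x, y) ∂ν)) μ := by
  refine integrable_matFun_of_le hΦ hcont h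
    (fun x => HermMat.integral_nonneg (Eventually.of_forall fun y => h0 (x, y)))
    hf.integral_prod_left hfΦ.integral_prod_left ?_
  filter_upwards [hf.prod_right_ae, hfΦ.prod_right_ae] with x hx hxΦ
  exact matFun_integral_le hΦ hcont h (fun y => h0 (x, y)) hx hxΦ

/-- The right side is the integral of the divergence of `f` from `W`, the left side that of `V` from
`M`; Jensen in `y` compares them for almost every `x`. `V` and `W` are partial integrals only almost
everywhere, because a non-integrable section has integral `0` while `W` must be positive definite at
every point. -/
theorem entropy_two_blocks_of_posDefH (hΦ : TwiceFrechetDiff Φ d) (hcont : ContinuousOn Φ (Ici 0))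
    (h : ConvexOn ℝ (pairsPDAdd d) (fun p => bregman Φ p.1 p.2)) {f : S₁ × S₂ → HermMat d}
    {V : S₁ → HermMat d} {W : S₂ → HermMat d} (hfp : ∀ z, PosDefH (f z))
    (hWp : ∀ y, PosDefH (W y)) (hf : Integrable f (μ.prod ν))
    (hfΦ : Integrable (fun z => matFun Φ (f z)) (μ.prod ν))
    (hV : ∀ᵐ x ∂μ, V x = ∫ y, f (x, y) ∂ν) (hW : ∀ᵐ y ∂ν, W y = ∫ x, f (x, y) ∂μ)
    (hVΦ : Integrable (fun x => matFun Φ (V x)) μ)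
    (hWΦ : Integrable (fun y => matFun Φ (W y)) ν) :
    (∫ x, matFun Φ (V x) ∂μ) - matFun Φ (∫ z, f z ∂(μ.prod ν)) ≤
      (∫ z, matFun Φ (f z) ∂(μ.prod ν)) - ∫ y, matFun Φ (W y) ∂ν := by
  refine HermMat.le_iff_quadForm.2 fun v => ?_
  set M := ∫ z, f z ∂(μ.prod ν) with hM_def
  have hVi : Integrable V μ := hf.integral_prod_left.congr (hV.mono fun x hx => hx.symm)
  have hWi : Integrable W ν := hf.integral_prod_right.congr (hW.mono fun x hx => hx.symm)
  have hVM : ∫ x, V x ∂μ = M := by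
    rw [integral_congr_ae hV, hM_def, integral_prod _ hf]
  have hWM : ∫ y, W y ∂ν = M := by
    rw [integral_congr_ae hW, hM_def, integral_prod_symm _ hf]
  have hMp : PosDefH M := posDefH_integral hf (Eventually.of_forall hfp)
  let G : S₁ × S₂ → ℝ := fun z => quadForm v (bregman Φ (W z.2) (f z - W z.2))
  have hG : ∀ z, G z = quadForm v (matFun Φ (f z)) - quadForm v (matFun Φ (W z.2)) -
      quadForm v (dMat Φ (W z.2) (f z - W z.2)) := fun z => by
    simp only [G, bregman, add_sub_cancel, map_sub]
  have hG0 : ∀ z, 0 ≤ G z := fun z => HermMat.nonneg_iff_quadForm.1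
    (bregman_nonneg hΦ h (hWp z.2) (by simpa using hfp z)) v
  have hGm : AEStronglyMeasurable G (μ.prod ν) := by
    have hWm : AEStronglyMeasurable (fun z : S₁ × S₂ => W z.2) (μ.prod ν) := hWi.1.comp_snd
    have h1 := aestronglyMeasurable_dMat hΦ hcont (fun z : S₁ × S₂ => hWp z.2) hWm (hf.1.sub hWm)
    have h2 := (hfΦ.1.sub (hWΦ.1.comp_snd (μ := μ))).sub h1
    refine ((quadForm v).continuous.comp_aestronglyMeasurable h2).congr
      (Eventually.of_forall fun z => ?_)
    simp [hG]
  -- At fixed `y` the derivative term is linear in `f (x, y) - W y`, which has mean zero over `x`.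
  have hsec : ∀ᵐ y ∂ν, Integrable (fun x => G (x, y)) μ ∧
      ∫ x, G (x, y) ∂μ = quadForm v (∫ x, matFun Φ (f (x, y)) ∂μ) - quadForm v (matFun Φ (W y)) := by
    filter_upwards [hf.prod_left_ae, hfΦ.prod_left_ae, hW] with y h1 h2 h3
    obtain ⟨h4, h5⟩ := integral_dMat_sub (Φ := Φ) (integrable_const (W y)) h1 (W y)
    rw [← h3] at h5
    simp only [integral_const, probReal_univ, one_smul, sub_self, dMat_zero] at h5
    have h6 : Integrable (fun x => quadForm v (matFun Φ (f (x, y))) -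
        quadForm v (matFun Φ (W y))) μ :=
      (integrable_quadForm v h2).sub (integrable_const _)
    have h7 := integrable_quadForm v h4
    refine ⟨(h6.sub h7).congr (Eventually.of_forall fun x => (hG (x, y)).symm), ?_⟩
    simp only [hG]
    rw [integral_sub h6 h7, ← quadForm_integral v h4, h5, map_zero, sub_zero,
      integral_sub (integrable_quadForm v h2) (integrable_const _), ← quadForm_integral v h2]
    simp
  have hi1 : Integrable (fun y => quadForm v (∫ x, matFun Φ (f (x, y)) ∂μ)) ν :=
    integrable_quadForm v hfΦ.integral_prod_right
  have hi2 : Integrable (fun y => quadForm v (matFun Φ (W y))) ν := integrable_quadForm v hWΦ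
  -- As `G ≥ 0`, finite iterated integrals suffice; joint integrability of the derivative term alone
  -- is never needed.
  have hGi : Integrable G (μ.prod ν) := by
    refine (integrable_prod_iff' hGm).2 ⟨hsec.mono fun y hy => hy.1, ?_⟩
    refine (hi1.sub hi2).congr ?_
    filter_upwards [hsec] with y hy
    simp only [Real.norm_of_nonneg (hG0 _), hy.2, Pi.sub_apply]
  have hGint : ∫ z, G z ∂(μ.prod ν) =
      quadForm v ((∫ z, matFun Φ (f z) ∂(μ.prod ν)) - ∫ y, matFun Φ (W y) ∂ν) := by
    rw [integral_prod_symm _ hGi, integral_congr_ae (hsec.mono fun y hy => hy.2),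
      integral_sub hi1 hi2, ← quadForm_integral v hfΦ.integral_prod_right,
      ← quadForm_integral v hWΦ, map_sub, integral_prod_symm _ hfΦ]
  have hJ : ∀ᵐ x ∂μ, quadForm v (bregman Φ M (V x - M)) ≤ ∫ y, G (x, y) ∂ν := by
    filter_upwards [hGi.prod_right_ae, hf.prod_right_ae, hV] with x h1 h2 h3
    have := quadForm_bregman_integral_le hΦ h v (Eventually.of_forall hWp)
      (Eventually.of_forall fun y => hfp (x, y)) hWi h2 h1
    rwa [hWM, ← h3] at this
  obtain ⟨h4, h5⟩ := integral_dMat_sub (Φ := Φ) (integrable_const M) hVi M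
  have hk1 : Integrable (fun x => quadForm v (matFun Φ (V x)) - quadForm v (matFun Φ M)) μ :=
    (integrable_quadForm v hVΦ).sub (integrable_const _)
  have hk : ∀ x, quadForm v (bregman Φ M (V x - M)) = quadForm v (matFun Φ (V x)) -
      quadForm v (matFun Φ M) - quadForm v (dMat Φ M (V x - M)) := fun x => by
    simp only [bregman, add_sub_cancel, map_sub]
  have hbi : Integrable (fun x => quadForm v (bregman Φ M (V x - M))) μ :=
    (hk1.sub (integrable_quadForm v h4)).congr (Eventually.of_forall fun x => (hk x).symm)
  have hle := integral_mono_ae hbi hGi.integral_prod_left hJ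
  rw [← integral_prod _ hGi, hGint] at hle
  refine le_trans (le_of_eq ?_) hle
  simp only [hk]
  rw [integral_sub hk1 (integrable_quadForm v h4), ← quadForm_integral v h4, h5, hVM,
    integral_sub (integrable_quadForm v hVΦ) (integrable_const _), ← quadForm_integral v hVΦ]
  simp [dMat_zero]

end TwoBlocks

/-- Dominated convergence: the integrand lies between the tangent at `1` and the chord from `Z ω` to
`1`, both bounded in norm independently of `s`. -/
theorem tendsto_integral_matFun_shrink {Φ : ℝ → ℝ} (hΦ : TwiceFrechetDiff Φ d)
    (hcont : ContinuousOn Φ (Ici 0)) (h : ConvexOn ℝ (pairsPDAdd d) (fun p => bregman Φ p.1 p.2))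
    {Ω : Type*} [MeasurableSpace Ω] {P : Measure Ω} [IsFiniteMeasure P] {Z : Ω → HermMat d}
    (h0 : ∀ ω, 0 ≤ Z ω) (hZ : Integrable Z P) (hZΦ : Integrable (fun ω => matFun Φ (Z ω)) P) :
    Tendsto (fun s : ℝ => ∫ ω, matFun Φ ((1 - s) • Z ω + s • 1) ∂P) (𝓝[>] 0)
      (𝓝 (∫ ω, matFun Φ (Z ω) ∂P)) := by
  set D := fderiv ℝ (matFun Φ) (1 : HermMat d) with hD
  have hs : ∀ᶠ s : ℝ in 𝓝[>] 0, s ∈ Ioo (0 : ℝ) 1 := Ioo_mem_nhdsGT zero_lt_one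
  have hmem : ∀ s ∈ Ioo (0 : ℝ) 1, ∀ ω, 0 ≤ (1 - s) • Z ω + s • (1 : HermMat d) :=
    fun s hs ω => convex_nonneg_hermMat (h0 ω) posDefH_one.nonneg (sub_nonneg.2 hs.2.le) hs.1.le
      (by ring)
  refine tendsto_integral_filter_of_dominated_convergence
    (fun ω => 2 * (‖matFun Φ (1 : HermMat d)‖ + ‖D‖ * (‖Z ω‖ + ‖(1 : HermMat d)‖)) +
      (‖matFun Φ (Z ω)‖ + ‖matFun Φ (1 : HermMat d)‖)) ?_ ?_ ?_ ?_
  · filter_upwards [hs] with s hs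
    exact aestronglyMeasurable_matFun_comp hcont
      ((hZ.1.const_smul (1 - s)).add aestronglyMeasurable_const) (hmem s hs)
  · filter_upwards [hs] with s hs
    refine Eventually.of_forall fun ω => ?_
    have hL := matFun_tangent_le hΦ hcont h posDefH_one (hmem s hs ω)
    have hU := (convexOn_matFun hΦ hcont h).2 (h0 ω) posDefH_one.nonneg (sub_nonneg.2 hs.2.le)
      hs.1.le (by ring)
    refine (HermMat.norm_le_of_le_of_le hL hU).trans ?_
    have hn : ∀ A : HermMat d, ‖(1 - s) • A‖ ≤ ‖A‖ := fun A => by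
      rw [norm_smul, Real.norm_of_nonneg (sub_nonneg.2 hs.2.le)]
      exact mul_le_of_le_one_left (norm_nonneg _) (by linarith [hs.1])
    have hn' : ‖s • matFun Φ (1 : HermMat d)‖ ≤ ‖matFun Φ (1 : HermMat d)‖ := by
      rw [norm_smul, Real.norm_of_nonneg hs.1.le]
      exact mul_le_of_le_one_left (norm_nonneg _) hs.2.le
    have he : (1 - s) • Z ω + s • (1 : HermMat d) - 1 = (1 - s) • (Z ω - 1) := by module
    gcongr
    · refine (norm_add_le _ _).trans (add_le_add_right ?_ _)
      rw [he]
      refine (D.le_opNorm _).trans ?_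
      gcongr
      exact (hn _).trans (norm_sub_le _ _)
    · exact (norm_add_le _ _).trans (add_le_add (hn _) hn')
  · exact (((integrable_const _).add ((hZ.norm.add (integrable_const _)).const_mul _)).const_mul
      2).add (hZΦ.norm.add (integrable_const _))
  · refine Eventually.of_forall fun ω => ?_
    have h1 : Tendsto (fun s : ℝ => (1 - s) • Z ω + s • (1 : HermMat d)) (𝓝[>] 0)
        (𝓝[{A | 0 ≤ A}] (Z ω)) := by
      refine tendsto_nhdsWithin_iff.2 ⟨?_, ?_⟩
      · have : ContinuousAt (fun s : ℝ => (1 - s) • Z ω + s • (1 : HermMat d)) 0 := by fun_prop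
        simpa using this.tendsto.mono_left nhdsWithin_le_nhds
      · filter_upwards [hs] with s hs using hmem s hs ω
    exact (continuousOn_matFun hcont (Z ω) (h0 ω)).tendsto.comp h1

theorem integral_shrink {Ω : Type*} [MeasurableSpace Ω] {P : Measure Ω} [IsProbabilityMeasure P]
    {Z : Ω → HermMat d} (hZ : Integrable Z P) (s : ℝ) :
    ∫ ω, ((1 - s) • Z ω + s • (1 : HermMat d)) ∂P = (1 - s) • ∫ ω, Z ω ∂P + s • 1 := by
  have := integral_add (hZ.smul (1 - s)) (integrable_const (μ := P) (s • (1 : HermMat d)))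
  simp only [Pi.smul_apply, integral_smul, integral_const, probReal_univ, one_smul] at this
  exact this

theorem integrable_matFun_shrink {Φ : ℝ → ℝ} (hΦ : TwiceFrechetDiff Φ d)
    (hcont : ContinuousOn Φ (Ici 0)) (h : ConvexOn ℝ (pairsPDAdd d) (fun p => bregman Φ p.1 p.2))
    {Ω : Type*} [MeasurableSpace Ω] {P : Measure Ω} [IsFiniteMeasure P] {Z : Ω → HermMat d}
    (h0 : ∀ ω, 0 ≤ Z ω) (hZ : Integrable Z P) (hZΦ : Integrable (fun ω => matFun Φ (Z ω)) P)
    {s : ℝ} (hs : s ∈ Ioo (0 : ℝ) 1) :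
    Integrable (fun ω => matFun Φ ((1 - s) • Z ω + s • (1 : HermMat d))) P :=
  integrable_matFun_comb hΦ hcont h h0 (fun _ => posDefH_one.nonneg) hZ (integrable_const _) hZΦ
    (integrable_const _) (sub_nonneg.2 hs.2.le) hs.1.le (by ring)

theorem entropy_two_blocks {Φ : ℝ → ℝ} {S₁ S₂ : Type*} [MeasurableSpace S₁] [MeasurableSpace S₂]
    {μ : Measure S₁} {ν : Measure S₂} [IsProbabilityMeasure μ] [IsProbabilityMeasure ν]
    (hΦ : TwiceFrechetDiff Φ d) (hcont : ContinuousOn Φ (Ici 0))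
    (h : ConvexOn ℝ (pairsPDAdd d) (fun p => bregman Φ p.1 p.2)) {f : S₁ × S₂ → HermMat d}
    (h0 : ∀ z, 0 ≤ f z) (hf : Integrable f (μ.prod ν))
    (hfΦ : Integrable (fun z => matFun Φ (f z)) (μ.prod ν)) :
    (∫ x, matFun Φ (∫ y, f (x, y) ∂ν) ∂μ) - matFun Φ (∫ z, f z ∂(μ.prod ν)) ≤
      (∫ z, matFun Φ (f z) ∂(μ.prod ν)) - ∫ y, matFun Φ (∫ x, f (x, y) ∂μ) ∂ν := by
  have hV0 : ∀ x, 0 ≤ ∫ y, f (x, y) ∂ν := fun x =>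
    HermMat.integral_nonneg (Eventually.of_forall fun y => h0 (x, y))
  have hW0 : ∀ y, 0 ≤ ∫ x, f (x, y) ∂μ := fun y =>
    HermMat.integral_nonneg (Eventually.of_forall fun x => h0 (x, y))
  have hVΦ := integrable_matFun_integral hΦ hcont h h0 hf hfΦ
  have hWΦ : Integrable (fun y => matFun Φ (∫ x, f (x, y) ∂μ)) ν :=
    integrable_matFun_integral hΦ hcont h (fun z => h0 z.swap) hf.swap hfΦ.swap
  have hM0 : 0 ≤ ∫ z, f z ∂(μ.prod ν) := HermMat.integral_nonneg (Eventually.of_forall h0)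
  -- Applied to a constant function, this is the convergence at the single matrix `∫ z, f z`.
  have hlM := tendsto_integral_matFun_shrink (P := μ) hΦ hcont h
    (fun _ => hM0) (integrable_const _) (integrable_const _)
  simp only [integral_const, probReal_univ, one_smul] at hlM
  refine le_of_tendsto_of_tendsto
    ((tendsto_integral_matFun_shrink hΦ hcont h hV0 hf.integral_prod_left hVΦ).sub hlM)
    ((tendsto_integral_matFun_shrink hΦ hcont h h0 hf hfΦ).sub
      (tendsto_integral_matFun_shrink hΦ hcont h hW0 hf.integral_prod_right hWΦ)) ?_
  filter_upwards [Ioo_mem_nhdsGT (zero_lt_one' ℝ)] with s hs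
  have hs1 : 0 ≤ 1 - s := sub_nonneg.2 hs.2.le
  have hpd : ∀ A : HermMat d, 0 ≤ A → PosDefH ((1 - s) • A + s • (1 : HermMat d)) :=
    fun A hA => by
      rw [add_comm]
      exact (posDefH_one.smul hs.1).add_nonneg (HermMat.smul_nonneg hA hs1)
  have key := entropy_two_blocks_of_posDefH (μ := μ) (ν := ν) hΦ hcont h
    (f := fun z => (1 - s) • f z + s • (1 : HermMat d))
    (V := fun x => (1 - s) • ∫ y, f (x, y) ∂ν + s • (1 : HermMat d))
    (W := fun y => (1 - s) • ∫ x, f (x, y) ∂μ + s • (1 : HermMat d))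
    (fun z => hpd _ (h0 z)) (fun y => hpd _ (hW0 y))
    ((hf.smul (1 - s)).add (integrable_const _)) (integrable_matFun_shrink hΦ hcont h h0 hf hfΦ hs)
    (hf.prod_right_ae.mono fun x hx => (integral_shrink hx s).symm)
    (hf.prod_left_ae.mono fun y hy => (integral_shrink hy s).symm)
    (integrable_matFun_shrink hΦ hcont h hV0 hf.integral_prod_left hVΦ hs)
    (integrable_matFun_shrink hΦ hcont h hW0 hf.integral_prod_right hWΦ hs)
  rw [integral_shrink hf] at key
  exact key

/-! ### Conditional Jensen inequality -/

theorem condJensen_of_bregman {Φ : ℝ → ℝ} (hΦ : IsEntropyFun Φ)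
    (h : ∀ d : ℕ, ConvexOn ℝ (pairsPDAdd d) (fun p => bregman Φ p.1 p.2)) :
    CondJensen.{u} Φ := by
  intro d Ω S₁ S₂ _ _ _ _ _ _ _ _ _ P _ X₁ X₂ f hX₁ hX₂ hind hf h0 hmem
  have := Measure.isProbabilityMeasure_map (μ := P) hX₁.aemeasurable
  have := Measure.isProbabilityMeasure_map (μ := P) hX₂.aemeasurable
  have hlaw := (indepFun_iff_map_prod_eq_prod_map_map hX₁.aemeasurable hX₂.aemeasurable).1 hind
  set μ := P.map X₁
  set ν := P.map X₂
  have hfΦm := stronglyMeasurable_matFun_comp hΦ.continuousOn hf h0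
  have hX : AEMeasurable (fun ω => (X₁ ω, X₂ ω)) P := (hX₁.prodMk hX₂).aemeasurable
  have hfi : Integrable f (μ.prod ν) := by
    rw [← hlaw]
    exact (integrable_map_measure hf.aestronglyMeasurable hX).2 hmem.2.1
  have hfΦ : Integrable (fun z => matFun Φ (f z)) (μ.prod ν) := by
    rw [← hlaw]
    exact (integrable_map_measure hfΦm.aestronglyMeasurable hX).2 hmem.2.2
  have hVΦ := integrable_matFun_integral (hΦ.twiceFrechetDiff d) hΦ.continuousOn (h d) h0 hfi hfΦ
  have hWΦ : Integrable (fun y => matFun Φ (∫ x, f (x, y) ∂μ)) ν :=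
    integrable_matFun_integral (hΦ.twiceFrechetDiff d) hΦ.continuousOn (h d)
      (fun z => h0 z.swap) hfi.swap hfΦ.swap
  have key := entropy_two_blocks (hΦ.twiceFrechetDiff d) hΦ.continuousOn (h d) h0 hfi hfΦ
  have e1 : ∫ ω, matFun Φ (∫ x, f (x, X₂ ω) ∂μ) ∂P = ∫ y, matFun Φ (∫ x, f (x, y) ∂μ) ∂ν :=
    (integral_map hX₂.aemeasurable hWΦ.1).symm
  have e2 : ∫ ω, ∫ x, f (x, X₂ ω) ∂μ ∂P = ∫ z, f z ∂(μ.prod ν) := by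
    rw [integral_prod_symm _ hfi]
    exact (integral_map hX₂.aemeasurable hfi.integral_prod_right.1).symm
  have hE : Integrable (fun x => (∫ y, matFun Φ (f (x, y)) ∂ν) - matFun Φ (∫ y, f (x, y) ∂ν)) μ :=
    hfΦ.integral_prod_left.sub hVΦ
  have e3 : ∫ ω, opEntropy Φ ν (fun y => f (X₁ ω, y)) ∂P =
      ∫ x, ((∫ y, matFun Φ (f (x, y)) ∂ν) - matFun Φ (∫ y, f (x, y) ∂ν)) ∂μ :=
    (integral_map hX₁.aemeasurable hE.1).symm
  rw [e3, integral_sub hfΦ.integral_prod_left hVΦ, ← integral_prod _ hfΦ, opEntropy, e1, e2]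
  rw [← sub_nonneg] at key ⊢
  convert! key using 1
  abel

/-- On a product of two-point spaces, the first variable carries the convex combination of `p` and
`q`, the second the weights `t`, `1 - t` of the gap. -/
theorem convexOn_jensenGap_of_condJensen {Φ : ℝ → ℝ} (h : CondJensen.{u} Φ) (d : ℕ) {t : ℝ}
    (ht : t ∈ Icc (0 : ℝ) 1) : ConvexOn ℝ (pairsPSD d) (fun p => jensenGap Φ t p.1 p.2) := by
  refine ⟨convex_pairsPSD, fun p hp q hq a b ha hb hab => ?_⟩
  have hμ := isProbabilityMeasure_twoPoint.{u} ha hb hab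
  have hν := isProbabilityMeasure_twoPoint.{u} ht.1 (sub_nonneg.2 ht.2) (by ring)
  let f : ULift.{u} Bool × ULift.{u} Bool → HermMat d := fun z =>
    bif z.1.down then (bif z.2.down then p.1 else p.2) else (bif z.2.down then q.1 else q.2)
  have hf0 : ∀ z, 0 ≤ f z := by
    rintro ⟨⟨_ | _⟩, ⟨_ | _⟩⟩
    exacts [hq.2, hq.1, hp.2, hp.1]
  set μ := twoPoint.{u} a b
  set ν := twoPoint.{u} t (1 - t)
  have h1 : (μ.prod ν).map Prod.fst = μ := measurePreserving_fst.map_eq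
  have h2 : (μ.prod ν).map Prod.snd = ν := measurePreserving_snd.map_eq
  have hind : IndepFun Prod.fst Prod.snd (μ.prod ν) := by
    rw [indepFun_iff_map_prod_eq_prod_map_map measurable_fst.aemeasurable
      measurable_snd.aemeasurable, h1, h2]
    exact Measure.map_id
  have hle := h d _ _ _ (μ.prod ν) Prod.fst Prod.snd f measurable_fst measurable_snd hind
    .of_discrete hf0 ⟨fun _ => hf0 _, .of_finite, .of_finite⟩
  have e1 : ∀ F : ULift.{u} Bool → HermMat d,
      ∫ ω, F ω.2 ∂(μ.prod ν) = t • F ⟨true⟩ + (1 - t) • F ⟨false⟩ := fun F => by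
    rw [← integral_twoPoint ht.1 (sub_nonneg.2 ht.2) F, integral_prod _ .of_finite]
    simp [ν]
  have e2 : ∀ F : ULift.{u} Bool → HermMat d,
      ∫ ω, F ω.1 ∂(μ.prod ν) = a • F ⟨true⟩ + b • F ⟨false⟩ := fun F => by
    rw [← integral_twoPoint ha hb F, integral_prod _ .of_finite]
    simp [μ]
  rw [h1, h2, e2 fun x => opEntropy Φ ν fun y => f (x, y), opEntropy_twoPoint Φ ht,
    opEntropy_twoPoint Φ ht, opEntropy, e1 fun y => matFun Φ (∫ x, f (x, y) ∂μ),
    e1 fun y => ∫ x, f (x, y) ∂μ] at hle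
  simpa only [μ, integral_twoPoint ha hb, f, cond_true, cond_false, jensenGap,
    Prod.fst_add, Prod.snd_add, Prod.smul_fst, Prod.smul_snd] using hle

/-! ### Subadditivity -/

section Pi

variable {n : ℕ} {S : Fin n → Type*} [∀ i, MeasurableSpace (S i)] (μ : ∀ i, Measure (S i))
  [∀ i, IsProbabilityMeasure (μ i)]

/-- Resampling one coordinate independently preserves the product law. This turns integration over
one variable with the others fixed into a partial integral on a product of two spaces. -/
theorem measurePreserving_update (i : Fin n) :
    MeasurePreserving (fun p : (∀ j, S j) × S i => Function.update p.1 i p.2)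
      ((Measure.pi μ).prod (μ i)) (Measure.pi μ) := by
  refine ⟨measurable_update', (Measure.pi_eq fun s hs => ?_).symm⟩
  rw [Measure.map_apply measurable_update' (MeasurableSet.univ_pi hs)]
  have he : (fun p : (∀ j, S j) × S i => Function.update p.1 i p.2) ⁻¹' (univ.pi s) =
      (univ.pi (Function.update s i univ)) ×ˢ s i := by
    ext ⟨x, y⟩
    simp only [mem_preimage, mem_univ_pi, mem_prod]
    constructor
    · refine fun hx => ⟨fun j => ?_, by simpa using hx i⟩
      rcases eq_or_ne j i with rfl | hj
      · simp
      · simpa [hj] using hx j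
    · rintro ⟨hx, hy⟩ j
      rcases eq_or_ne j i with rfl | hj
      · simpa using hy
      · simpa [hj] using hx j
  rw [he, Measure.prod_prod, Measure.pi_pi, ← Finset.mul_prod_erase _ _ (Finset.mem_univ i),
    ← Finset.mul_prod_erase _ (fun j => μ j (s j)) (Finset.mem_univ i), mul_comm]
  congr 1
  simp only [Function.update_self, measure_univ, one_mul]
  refine Finset.prod_congr rfl fun j hj => ?_
  rw [Function.update_of_ne (Finset.ne_of_mem_erase hj)]

variable {μ}

theorem integrable_update {E : Type*} [NormedAddCommGroup E] {f : (∀ i, S i) → E}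
    (hf : Integrable f (Measure.pi μ)) (i : Fin n) :
    Integrable (fun p : (∀ j, S j) × S i => f (Function.update p.1 i p.2))
      ((Measure.pi μ).prod (μ i)) :=
  (measurePreserving_update μ i).integrable_comp_of_integrable hf

theorem integral_integral_update {E : Type*} [NormedAddCommGroup E] [NormedSpace ℝ E]
    {f : (∀ i, S i) → E} (hf : Integrable f (Measure.pi μ)) (i : Fin n) :
    ∫ x, ∫ y, f (Function.update x i y) ∂(μ i) ∂(Measure.pi μ) = ∫ x, f x ∂(Measure.pi μ) := by
  have hm := measurePreserving_update μ i
  rw [← integral_prod _ (integrable_update hf i)]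
  conv_rhs => rw [← hm.map_eq]
  exact (integral_map hm.measurable.aemeasurable (by rw [hm.map_eq]; exact hf.1)).symm

theorem integrable_matFun_integral_update {Φ : ℝ → ℝ} (hΦ : TwiceFrechetDiff Φ d)
    (hcont : ContinuousOn Φ (Ici 0)) (h : ConvexOn ℝ (pairsPDAdd d) (fun p => bregman Φ p.1 p.2))
    {f : (∀ i, S i) → HermMat d} (h0 : ∀ x, 0 ≤ f x) (hf : Integrable f (Measure.pi μ))
    (hfΦ : Integrable (fun x => matFun Φ (f x)) (Measure.pi μ)) (i : Fin n) :
    Integrable (fun x => matFun Φ (∫ y, f (Function.update x i y) ∂(μ i))) (Measure.pi μ) :=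
  integrable_matFun_integral hΦ hcont h (f := fun p => f (Function.update p.1 i p.2))
    (fun _ => h0 _) (integrable_update hf i) (integrable_update hfΦ i)

end Pi

theorem measurePreserving_finCons {n : ℕ} {S : Fin (n + 1) → Type*} [∀ i, MeasurableSpace (S i)]
    (μ : ∀ i, Measure (S i)) [∀ i, IsProbabilityMeasure (μ i)] :
    MeasurePreserving (fun p : S 0 × (∀ i : Fin n, S i.succ) => (Fin.cons p.1 p.2 : ∀ i, S i))
      ((μ 0).prod (Measure.pi fun i : Fin n => μ i.succ)) (Measure.pi μ) := by
  have := (measurePreserving_piFinSuccAbove μ 0).symm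
  convert! this using 1
  ext p i
  exact Fin.cases rfl (fun j => rfl) i

/-- Induction on `n`. The two-block inequality, with the first variable against the rest, bounds the
entropy by the term of the first variable plus the mean entropy of the sections of `f`, to which the
induction hypothesis applies almost everywhere. -/
theorem entropy_pi_le_sum {Φ : ℝ → ℝ} (hΦ : TwiceFrechetDiff Φ d) (hcont : ContinuousOn Φ (Ici 0))
    (h : ConvexOn ℝ (pairsPDAdd d) (fun p => bregman Φ p.1 p.2)) :
    ∀ (n : ℕ) (S : Fin n → Type u) [∀ i, MeasurableSpace (S i)] (μ : ∀ i, Measure (S i))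
      [∀ i, IsProbabilityMeasure (μ i)] (f : (∀ i, S i) → HermMat d), (∀ x, 0 ≤ f x) →
      Integrable f (Measure.pi μ) → Integrable (fun x => matFun Φ (f x)) (Measure.pi μ) →
      opEntropy Φ (Measure.pi μ) f ≤ ∑ i, ((∫ x, matFun Φ (f x) ∂(Measure.pi μ)) -
        ∫ x, matFun Φ (∫ y, f (Function.update x i y) ∂(μ i)) ∂(Measure.pi μ)) := by
  intro n
  induction n with
  | zero =>
    intro S _ μ _ f _ _ _
    -- With no variables the product is a single point, so `f` is constant and both sides vanish.
    obtain ⟨c, rfl⟩ : ∃ c, f = fun _ => c :=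
      ⟨f default, funext fun x => by rw [Subsingleton.elim x default]⟩
    simp [opEntropy]
  | succ n ih =>
    intro S _ μ _ f h0 hf hfΦ
    have hm := measurePreserving_finCons μ
    set τ := Measure.pi fun i : Fin n => μ i.succ with hτ
    let g : S 0 × (∀ i : Fin n, S i.succ) → HermMat d := fun p => f (Fin.cons p.1 p.2)
    have hint : ∀ F : (∀ i, S i) → HermMat d, Integrable F (Measure.pi μ) →
        Integrable (fun p : S 0 × (∀ i : Fin n, S i.succ) => F (Fin.cons p.1 p.2)) ((μ 0).prod τ) ∧
        ∫ p : S 0 × (∀ i : Fin n, S i.succ), F (Fin.cons p.1 p.2) ∂((μ 0).prod τ) =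
          ∫ x, F x ∂(Measure.pi μ) := by
      intro F hF
      refine ⟨hm.integrable_comp_of_integrable hF, ?_⟩
      conv_rhs => rw [← hm.map_eq]
      exact (integral_map hm.measurable.aemeasurable (by rw [hm.map_eq]; exact hF.1)).symm
    obtain ⟨hg, hgI⟩ := hint f hf
    obtain ⟨hgΦ, hgΦI⟩ := hint _ hfΦ
    have hup := fun i => hint _ (integrable_matFun_integral_update hΦ hcont h h0 hf hfΦ i)
    have hVΦ := integrable_matFun_integral hΦ hcont h (f := g) (fun _ => h0 _) hg hgΦ
    have hWΦ : Integrable (fun t => matFun Φ (∫ x, g (x, t) ∂(μ 0))) τ :=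
      integrable_matFun_integral hΦ hcont h (f := fun z => g z.swap) (fun _ => h0 _) hg.swap
        hgΦ.swap
    have key := entropy_two_blocks hΦ hcont h (f := g) (fun _ => h0 _) hg hgΦ
    -- Once the first coordinate is integrated out, the integrand depends on the remaining ones
    -- only.
    have hzero : ∫ x, matFun Φ (∫ y, f (Function.update x 0 y) ∂(μ 0)) ∂(Measure.pi μ) =
        ∫ t, matFun Φ (∫ x, g (x, t) ∂(μ 0)) ∂τ := by
      rw [← (hup 0).2]
      simp only [Fin.update_cons_zero]
      have := integral_prod_symm _ (hWΦ.comp_snd (μ 0))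
      simpa using this
    have hsucc : ∀ i : Fin n,
        ∫ x, matFun Φ (∫ y, f (Function.update x i.succ y) ∂(μ i.succ)) ∂(Measure.pi μ) =
          ∫ x, ∫ t, matFun Φ (∫ y, g (x, Function.update t i y) ∂(μ i.succ)) ∂τ ∂(μ 0) := by
      intro i
      rw [← (hup i.succ).2, integral_prod _ (hup i.succ).1]
      simp only [g, Fin.cons_update]
    have hsuccI : ∀ i : Fin n, Integrable
        (fun x => ∫ t, matFun Φ (∫ y, g (x, Function.update t i y) ∂(μ i.succ)) ∂τ) (μ 0) := by
      intro i
      have := (hup i.succ).1.integral_prod_left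
      simpa only [g, Fin.cons_update] using this
    have hdiff : ∀ i : Fin n, Integrable (fun x => (∫ t, matFun Φ (g (x, t)) ∂τ) -
        ∫ t, matFun Φ (∫ y, g (x, Function.update t i y) ∂(μ i.succ)) ∂τ) (μ 0) :=
      fun i => hgΦ.integral_prod_left.sub (hsuccI i)
    have hstep : ∫ x, opEntropy Φ τ (fun t => g (x, t)) ∂(μ 0) ≤
        ∫ x, ∑ i : Fin n, ((∫ t, matFun Φ (g (x, t)) ∂τ) -
          ∫ t, matFun Φ (∫ y, g (x, Function.update t i y) ∂(μ i.succ)) ∂τ) ∂(μ 0) := by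
      refine HermMat.integral_mono (hgΦ.integral_prod_left.sub hVΦ)
        (integrable_finsetSum _ fun i _ => hdiff i) ?_
      filter_upwards [hg.prod_right_ae, hgΦ.prod_right_ae] with x h1 h2
      exact ih _ (fun i => μ i.succ) (fun t => g (x, t)) (fun _ => h0 _) h1 h2
    rw [integral_finsetSum _ fun i _ => hdiff i] at hstep
    have hsub : ∀ i : Fin n, ∫ x, ((∫ t, matFun Φ (g (x, t)) ∂τ) -
          ∫ t, matFun Φ (∫ y, g (x, Function.update t i y) ∂(μ i.succ)) ∂τ) ∂(μ 0) =
        (∫ x, matFun Φ (f x) ∂(Measure.pi μ)) -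
          ∫ x, matFun Φ (∫ y, f (Function.update x i.succ y) ∂(μ i.succ)) ∂(Measure.pi μ) := by
      intro i
      rw [integral_sub hgΦ.integral_prod_left (hsuccI i), hsucc, ← integral_prod _ hgΦ, hgΦI]
    have hent : ∫ x, opEntropy Φ τ (fun t => g (x, t)) ∂(μ 0) =
        (∫ x, matFun Φ (f x) ∂(Measure.pi μ)) - ∫ x, matFun Φ (∫ t, g (x, t) ∂τ) ∂(μ 0) := by
      rw [← hgΦI, integral_prod _ hgΦ]
      exact integral_sub hgΦ.integral_prod_left hVΦ
    rw [hent, Finset.sum_congr rfl fun i _ => hsub i] at hstep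
    rw [Fin.sum_univ_succ, hzero, opEntropy]
    have hgI' : ∫ z, g z ∂((μ 0).prod τ) = ∫ x, f x ∂(Measure.pi μ) := hgI
    have hgΦI' : ∫ z, matFun Φ (g z) ∂((μ 0).prod τ) = ∫ x, matFun Φ (f x) ∂(Measure.pi μ) := hgΦI
    rw [hgI', hgΦI'] at key
    refine le_trans ?_ (add_le_add_right hstep _)
    rw [← sub_nonneg] at key ⊢
    convert! key using 1
    abel

theorem entropySubadditive_of_bregman {Φ : ℝ → ℝ} (hΦ : IsEntropyFun Φ)
    (h : ∀ d : ℕ, ConvexOn ℝ (pairsPDAdd d) (fun p => bregman Φ p.1 p.2)) :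
    EntropySubadditive.{u} Φ := by
  intro d n Ω S _ _ _ _ _ P _ X f hX hind hf h0 hmem
  have : ∀ i, IsProbabilityMeasure (P.map (X i)) := fun i =>
    Measure.isProbabilityMeasure_map (hX i).aemeasurable
  have hlaw := (iIndepFun_iff_map_fun_eq_pi_map fun i => (hX i).aemeasurable).1 hind
  have hXm : AEMeasurable (fun ω j => X j ω) P := (measurable_pi_iff.2 hX).aemeasurable
  set μ := fun i => P.map (X i) with hμ
  have hfΦm := stronglyMeasurable_matFun_comp hΦ.continuousOn hf h0
  have hfi : Integrable f (Measure.pi μ) := by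
    rw [← hlaw]
    exact (integrable_map_measure hf.aestronglyMeasurable hXm).2 hmem.2.1
  have hfΦ : Integrable (fun z => matFun Φ (f z)) (Measure.pi μ) := by
    rw [← hlaw]
    exact (integrable_map_measure hfΦm.aestronglyMeasurable hXm).2 hmem.2.2
  have hmap : ∀ F : (∀ i, S i) → HermMat d, AEStronglyMeasurable F (Measure.pi μ) →
      ∫ ω, F (fun j => X j ω) ∂P = ∫ x, F x ∂(Measure.pi μ) := by
    intro F hF
    rw [← hlaw] at hF ⊢
    exact (integral_map hXm hF).symm
  have key := entropy_pi_le_sum (hΦ.twiceFrechetDiff d) hΦ.continuousOn (h d) n S μ f h0 hfi hfΦ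
  have e1 : opEntropy Φ P (fun ω => f (fun j => X j ω)) = opEntropy Φ (Measure.pi μ) f := by
    rw [opEntropy, opEntropy, hmap f hfi.1, hmap (fun x => matFun Φ (f x)) hfΦ.1]
  rw [e1]
  refine key.trans (le_of_eq (Finset.sum_congr rfl fun i _ => ?_))
  have hu := integrable_matFun_integral_update (hΦ.twiceFrechetDiff d) hΦ.continuousOn (h d) h0
    hfi hfΦ i
  have hv := (integrable_update hfΦ i).integral_prod_left
  rw [hmap (fun x => opEntropy Φ (P.map (X i)) fun y => f (Function.update x i y))
    (hv.sub hu).1]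
  rw [← integral_integral_update hfΦ i]
  exact (integral_sub hv hu).symm

/-- For two variables, subadditivity is a rearrangement of the conditional Jensen inequality, so the
same four-point test works. -/
theorem convexOn_jensenGap_of_entropySubadditive {Φ : ℝ → ℝ} (h : EntropySubadditive.{u} Φ)
    (d : ℕ) {t : ℝ} (ht : t ∈ Icc (0 : ℝ) 1) :
    ConvexOn ℝ (pairsPSD d) (fun p => jensenGap Φ t p.1 p.2) := by
  refine ⟨convex_pairsPSD, fun p hp q hq a b ha hb hab => ?_⟩
  have hμ := isProbabilityMeasure_twoPoint.{u} ha hb hab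
  have hν := isProbabilityMeasure_twoPoint.{u} ht.1 (sub_nonneg.2 ht.2) (by ring)
  let f : ULift.{u} Bool × ULift.{u} Bool → HermMat d := fun z =>
    bif z.1.down then (bif z.2.down then p.1 else p.2) else (bif z.2.down then q.1 else q.2)
  have hf0 : ∀ z, 0 ≤ f z := by
    rintro ⟨⟨_ | _⟩, ⟨_ | _⟩⟩
    exacts [hq.2, hq.1, hp.2, hp.1]
  set μ := twoPoint.{u} a b
  set ν := twoPoint.{u} t (1 - t)
  let X : Fin 2 → ULift.{u} Bool × ULift.{u} Bool → ULift.{u} Bool := ![Prod.fst, Prod.snd]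
  have hX : ∀ i, Measurable (X i) := fun i => .of_discrete
  have h1 : (μ.prod ν).map (X 0) = μ := measurePreserving_fst.map_eq
  have h2 : (μ.prod ν).map (X 1) = ν := measurePreserving_snd.map_eq
  have hind : iIndepFun X (μ.prod ν) := by
    rw [iIndepFun_iff_map_fun_eq_pi_map fun i => (hX i).aemeasurable]
    have hpi : (fun i => (μ.prod ν).map (X i)) = ![μ, ν] := by
      ext1 i
      fin_cases i
      exacts [h1, h2]
    rw [hpi]
    have := (measurePreserving_finTwoArrow_vec μ ν).symm.map_eq
    convert! this using 2
    ext z i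
    fin_cases i <;> rfl
  have hS : ∀ _ : Fin 2, PolishSpace (ULift.{u} Bool) := fun _ => inferInstance
  have hle := h d 2 _ (fun _ => ULift.{u} Bool) (μ.prod ν) X (fun x => f (x 0, x 1)) hX hind
    .of_discrete (fun _ => hf0 _) ⟨fun _ => hf0 _, .of_finite, .of_finite⟩
  have e1 : ∀ F : ULift.{u} Bool × ULift.{u} Bool → HermMat d, ∫ z, F z ∂(μ.prod ν) =
      a • (t • F (⟨true⟩, ⟨true⟩) + (1 - t) • F (⟨true⟩, ⟨false⟩)) +
        b • (t • F (⟨false⟩, ⟨true⟩) + (1 - t) • F (⟨false⟩, ⟨false⟩)) := fun F => by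
    rw [integral_prod _ .of_finite, integral_twoPoint ha hb,
      integral_twoPoint ht.1 (sub_nonneg.2 ht.2), integral_twoPoint ht.1 (sub_nonneg.2 ht.2)]
  rw [Fin.sum_univ_two, h1, h2] at hle
  simp only [opEntropy, e1, X, Matrix.cons_val_zero, Matrix.cons_val_one, Function.update_self,
    ne_eq, one_ne_zero, zero_ne_one, not_false_eq_true, Function.update_of_ne,
    μ, ν, integral_twoPoint ha hb, integral_twoPoint ht.1 (sub_nonneg.2 ht.2), f, cond_true,
    cond_false] at hle
  have he : t • (a • p.1 + b • q.1) + (1 - t) • (a • p.2 + b • q.2) =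
      a • (t • p.1 + (1 - t) • p.2) + b • (t • q.1 + (1 - t) • q.2) := by module
  simp only [jensenGap, Prod.fst_add, Prod.snd_add, Prod.smul_fst, Prod.smul_snd, he]
  rw [← sub_nonneg] at hle ⊢
  convert! hle using 1
  obtain rfl : b = 1 - a := by linarith
  module

/-! ### The convex family of entropies -/

/-- Openness of `U` makes linearity of the first derivative hold near `x`, so it can be
differentiated again. -/
theorem fderiv_fderiv_linear_comb {E F : Type*} [NormedAddCommGroup E] [NormedSpace ℝ E]
    [NormedAddCommGroup F] [NormedSpace ℝ F] {f g : E → F} {U : Set E} (hU : IsOpen U)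
    (hf : ∀ x ∈ U, DifferentiableAt ℝ f x ∧ DifferentiableAt ℝ (fderiv ℝ f) x)
    (hg : ∀ x ∈ U, DifferentiableAt ℝ g x ∧ DifferentiableAt ℝ (fderiv ℝ g) x) (a b : ℝ) {x : E}
    (hx : x ∈ U) :
    DifferentiableAt ℝ (a • f + b • g) x ∧ DifferentiableAt ℝ (fderiv ℝ (a • f + b • g)) x ∧
      ∀ v w, fderiv ℝ (fderiv ℝ (a • f + b • g)) x v w =
        a • fderiv ℝ (fderiv ℝ f) x v w + b • fderiv ℝ (fderiv ℝ g) x v w := by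
  have h1 : fderiv ℝ (a • f + b • g) =ᶠ[𝓝 x] a • fderiv ℝ f + b • fderiv ℝ g := by
    filter_upwards [hU.mem_nhds hx] with y hy
    exact (((hf y hy).1.hasFDerivAt.const_smul a).add ((hg y hy).1.hasFDerivAt.const_smul b)).fderiv
  have h2 := (((hf x hx).2.hasFDerivAt.const_smul a).add
    ((hg x hx).2.hasFDerivAt.const_smul b)).congr_of_eventuallyEq h1
  exact ⟨((hf x hx).1.const_smul a).add ((hg x hx).1.const_smul b), h2.differentiableAt,
    fun v w => by rw [h2.fderiv]; rfl⟩

theorem entropyFamilyConvex : EntropyFamilyConvex.{u} := by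
  have hfun : ∀ (Φ Ψ : ℝ → ℝ) (a b : ℝ) (d : ℕ), (matFun (a • Φ + b • Ψ) : HermMat d → HermMat d) =
      a • matFun Φ + b • matFun Ψ := fun Φ Ψ a b d => funext fun A => matFun_linear_comb Φ Ψ a b A
  refine ⟨?_, ?_⟩
  · rintro Φ ⟨hΦ, hΦ3⟩ Ψ ⟨hΨ, hΨ3⟩ a b ha hb hab
    have hd := fun d => fun (A : HermMat d) (hA : PosDefH A) => fderiv_fderiv_linear_comb
      isOpen_posDefH (hΦ.twiceFrechetDiff d) (hΨ.twiceFrechetDiff d) a b hA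
    simp only [← hfun] at hd
    have htw : ∀ d, TwiceFrechetDiff (a • Φ + b • Ψ) d := fun d A hA =>
      ⟨(hd d A hA).1, (hd d A hA).2.1⟩
    refine ⟨⟨(hΦ.convexOn.smul ha).add (hΨ.convexOn.smul hb),
      (hΦ.continuousOn.const_smul a).add (hΨ.continuousOn.const_smul b), htw⟩,
      Set.mem_iInter.2 fun d => ⟨htw d, ?_⟩⟩
    have h1 := (convexOn_iff_quadForm.1 (Set.mem_iInter.1 hΦ3 d).2).2
    have h2 := (convexOn_iff_quadForm.1 (Set.mem_iInter.1 hΨ3 d).2).2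
    refine convexOn_iff_quadForm.2 ⟨convex_pairsPD, fun v =>
      (((h1 v).smul ha).add ((h2 v).smul hb)).congr fun p hp => ?_⟩
    simp only [d2Mat, (hd d p.1 hp).2.2]
    simp
  · intro Φ Ψ _ _ _ _ a b _ _ _ d Ω _ P _ Z hZ1 hZ2
    have h1 := hZ1.2.2.smul a
    have h2 := hZ2.2.2.smul b
    have hi : ∫ ω, matFun (a • Φ + b • Ψ) (Z ω) ∂P =
        a • ∫ ω, matFun Φ (Z ω) ∂P + b • ∫ ω, matFun Ψ (Z ω) ∂P := by
      simp only [matFun_linear_comb]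
      rw [← integral_smul, ← integral_smul]
      exact integral_add h1 h2
    refine ⟨⟨hZ1.1, hZ1.2.1, ?_⟩, ?_⟩
    · simp only [matFun_linear_comb]
      exact h1.add h2
    · simp only [opEntropy]
      rw [hi, matFun_linear_comb]
      module

end

/-! ### The cycle of implications -/

theorem theorem4p4 :
    (∀ Φ : ℝ → ℝ, IsEntropyFun Φ →
      List.TFAE [
        Φ ∈ classC3,
        ∀ d : ℕ, ConvexOn ℝ (pairsPDAdd d) (fun p => bregman Φ p.1 p.2),
        ∀ d : ℕ, ConvexOn ℝ (pairsPDAdd d)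
          (fun p => dMat Φ (p.1 + p.2) p.2 - dMat Φ p.1 p.2),
        ∀ d : ℕ, ConvexOn ℝ (pairsPD d) (fun p => d2Mat Φ p.1 p.2 p.2),
        ∀ d : ℕ, ∀ t ∈ Set.Icc (0 : ℝ) 1,
          ConvexOn ℝ (pairsPSD d) (fun p => jensenGap Φ t p.1 p.2),
        CondJensen.{u} Φ,
        EntropyConvex.{u} Φ,
        SupRepresentation.{u} Φ,
        EntropySubadditive.{u} Φ]) ∧
    EntropyFamilyConvex.{u} := by
  refine ⟨fun Φ hΦ => ?_, entropyFamilyConvex⟩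
  tfae_have 1 → 4 := fun h d => (Set.mem_iInter.1 h d).2
  tfae_have 4 → 1 := fun h => Set.mem_iInter.2 fun d => ⟨hΦ.twiceFrechetDiff d, h d⟩
  tfae_have 4 → 3 := fun h d => convexOn_dMat_sub_of_d2Mat (hΦ.twiceFrechetDiff d) (h d)
  tfae_have 3 → 4 := fun h d => secondDerivConvex_of_dMat_sub (hΦ.twiceFrechetDiff d) (h d)
  tfae_have 3 → 2 := fun h d => convexOn_bregman_of_dMat_sub (hΦ.twiceFrechetDiff d) (h d)
  tfae_have 2 → 3 := fun h d => convexOn_dMat_sub_of_bregman (h d)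
  tfae_have 2 → 5 := fun h d _ ht => convexOn_jensenGap_of_bregman hΦ.continuousOn (h d) ht
  tfae_have 5 → 2 := fun h d => convexOn_bregman_of_jensenGap (hΦ.twiceFrechetDiff d) (h d)
  tfae_have 2 → 6 := condJensen_of_bregman hΦ
  tfae_have 6 → 5 := fun h d _ ht => convexOn_jensenGap_of_condJensen h d ht
  tfae_have 2 → 7 := entropyConvex_of_bregman hΦ
  tfae_have 7 → 5 := fun h d _ ht => convexOn_jensenGap_of_entropyConvex h d ht
  tfae_have 2 → 8 := supRepresentation_of_bregman hΦ
  tfae_have 8 → 2 := convexOn_bregman_of_supRepresentation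
  tfae_have 2 → 9 := entropySubadditive_of_bregman hΦ
  tfae_have 9 → 5 := fun h d _ ht => convexOn_jensenGap_of_entropySubadditive h d ht
  tfae_finish
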